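/- **Conventions.** Let $F$ be a field. All abelian groups are tensored with $k=\mathbb Z[1/7!]$; write $V=F^\times\otimes k$ (additively, so that $-1\in F^\times$ has class $0$). For $n=2,3$ let $B_n(F)=k[F]/R_n(F)$ with generators $\{x\}_n$, where $R_n(F)$ is spanned by $\{0\}$ and by all $\alpha(0)-\alpha(1)$ with $\alpha=\sum_i n_i\{f_i(t)\}\in k[F(t)]$ in the kernel of $\delta_n$ (a term with a pole at the point of evaluation is dropped). Here $\delta_2\{x\}=(1-x)\wedge x\in\bigwedge^2V$ (zero for $x=0,1$) and $\delta_3\{x\}=\{x\}_2\otimes x\in B_2(F)\otimes V$ (zero for $x=0$), taken over the field $F(t)$. For vectors $v_1,\dots,v_N\in F^4$ in general position (any four linearly independent) let $(ijkl)=\det(v_i,v_j,v_k,v_l)$, $$(i_1i_2|i_3i_4i_5i_6)=\frac{(i_1i_2i_3i_5)(i_1i_2i_4i_6)}{(i_1i_2i_3i_6)(i_1i_2i_4i_5)},\qquad (i_1|i_2i_3i_4i_5i_6i_7)=\frac{(i_1i_2i_3i_5)(i_1i_3i_4i_6)(i_1i_4i_2i_7)}{(i_1i_2i_3i_6)(i_1i_3i_4i_7)(i_1i_4i_2i_5)},$$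 and let a subscript $(\cdots)_n$ denote the generator $\{(\cdots)\}_n$ of $B_n(F)$. $\mathrm{Alt}_N$ is the signed sum over all permutations of the $N$ points (no division by $N!$). Let $C_N(4)$ be the free $k$-module on $N$-tuples of vectors of $F^4$ in general position, $d(v_1,\dots,v_N)=\sum_{i=1}^N(-1)^{i-1}(v_1,\dots,\widehat{v_i},\dots,v_N)$, and let $f_7(4):C_7(4)\to (B_3(F)\otimes V)\oplus\bigwedge^2B_2(F)$ be the linear map $$f_7(4)(1,\dots,7)=2\,\mathrm{Alt}_7\big((1|234567)_3\otimes(2356)\big)+\tfrac37\,\mathrm{Alt}_7\big((12|3456)_2\wedge(34|1257)_2\big).$$ The symbol $\mathcal S$ is the linear map on $(B_3(F)\otimes V)\oplus\bigwedge^2B_2(F)$ given by $$\{a\}_3\otimes b\mapsto((1-a)\wedge a)\otimes a\otimes b,\qquad \{a\}_2\wedge\{b\}_2\mapsto((1-a)\wedge a)\wedge((1-b)\wedge b),$$ and $\delta$ is the component of the cobracket with values in $\bigwedge^2(\bigwedge^2V)$, the symbol space of $\bigwedge^2B_2$: it sends $(a\wedge b)\otimes c\otimes e$ to $(a\wedge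 b)\wedge(c\wedge e)$ and leaves $(a\wedge b)\wedge(c\wedge e)$ unchanged. For $x\in(B_3(F)\otimes V)\oplus\bigwedge^2B_2(F)$ the element $\delta(\mathcal S(x))$ is called the $\bigwedge^2B_2$-contribution of $x$ (both summands contribute to it). **Theorem.** (i) For all eight vectors in general position in $F^4$, the combination $$\Theta=\mathrm{Alt}_8\Big(28\,\big((1|234567)_3\otimes(1258)\big)-6\,\big((81|2345)_2\wedge(82|1567)_2\big)\Big)$$ is annihilated by $\delta\circ\mathcal S$. (ii) $\delta\circ\mathcal S\circ f_7(4)\circ d=0$ on $C_8(4)$, i.e. the $\bigwedge^2B_2$-contribution of $f_7(4)\circ d$ vanishes on every configuration of eight points. (iii) $\Theta$ is, up to the factor $-14$, the map $f_7(4)\circ d$ in dual form: if $v=(v_1,\dots,v_8)$ and $w=(w_1,\dots,w_8)$ are in general position in $F^4$ and dual to each other, i.e. $$\det(w_{\sigma1},w_{\sigma2},w_{\sigma3},w_{\sigma4})=\mathrm{sgn}(\sigma)\det(v_{\sigma5},v_{\sigma6},v_{\sigma7},v_{\sigma8})\quad\text{for all }\sigma\in\mathfrak S_8,$$ then $\Theta(w)=-14\,f_7(4)(d\,v)$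 in $(B_3(F)\otimes V)\oplus\bigwedge^2B_2(F)$. -/

import Mathlib

open scoped TensorProduct

noncomputable section

namespace Weight4

universe u

/-! ### Coefficients: everything is tensored with `ℤ[1/7!]` -/

/-- The coefficient ring `ℤ[1/7!]`. -/
def Coeff : Type := Localization.Away ((Nat.factorial 7 : ℕ) : ℤ)

instance : CommRing Coeff :=
  inferInstanceAs (CommRing (Localization.Away ((Nat.factorial 7 : ℕ) : ℤ)))

theorem isUnit_factorial : IsUnit ((Nat.factorial 7 : ℕ) : Coeff) := by
  have h : IsUnit (algebraMap ℤ (Localization.Away ((Nat.factorial 7 : ℕ) : ℤ))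
      ((Nat.factorial 7 : ℕ) : ℤ)) := IsLocalization.Away.algebraMap_isUnit _
  rw [eq_intCast, Int.cast_natCast] at h
  exact h

theorem isUnit_two : IsUnit (2 : Coeff) := by
  have h := isUnit_factorial
  have e : ((Nat.factorial 7 : ℕ) : Coeff) = 2 * 2520 := by norm_num [Nat.factorial]
  rw [e] at h
  exact isUnit_of_mul_isUnit_left h

theorem isUnit_seven : IsUnit (7 : Coeff) := by
  have h := isUnit_factorial
  have e : ((Nat.factorial 7 : ℕ) : Coeff) = 7 * 720 := by norm_num [Nat.factorial]
  rw [e] at h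
  exact isUnit_of_mul_isUnit_left h

/-- The fraction `3/7` in `ℤ[1/7!]`. -/
def threeSevenths : Coeff := 3 * ((isUnit_seven.unit⁻¹ : Coeffˣ) : Coeff)

/-! ### The multiplicative group and exterior squares -/

/-- `F^×`, written additively and tensored with `ℤ[1/7!]`. -/
def MulGrp (F : Type u) [Field F] : Type u := Coeff ⊗[ℤ] Additive Fˣ

instance (F : Type u) [Field F] : AddCommGroup (MulGrp F) :=
  inferInstanceAs (AddCommGroup (Coeff ⊗[ℤ] Additive Fˣ))

instance (F : Type u) [Field F] : Module Coeff (MulGrp F) :=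
  inferInstanceAs (Module Coeff (Coeff ⊗[ℤ] Additive Fˣ))

/-- The generator `1 ⊗ u` attached to a unit `u`. -/
def unitCls {F : Type u} [Field F] (u : Fˣ) : MulGrp F := (1 : Coeff) ⊗ₜ[ℤ] Additive.ofMul u

theorem unitCls_mul {F : Type u} [Field F] (u v : Fˣ) :
    unitCls (u * v) = unitCls u + unitCls v :=
  TensorProduct.tmul_add (1 : Coeff) (Additive.ofMul u) (Additive.ofMul v)

open Classical in
/-- The class of a nonzero element `x` in `F^×` (and, by convention, `0` for `x = 0`). -/
def cls {F : Type u} [Field F] (x : F) : MulGrp F :=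
  if h : x = 0 then 0 else unitCls (Units.mk0 x h)

/-- The exterior square `⋀² M` over `ℤ[1/7!]`. -/
def Ext2 (M : Type u) [AddCommGroup M] [Module Coeff M] : Type u := ⋀[Coeff]^2 M

instance (M : Type u) [AddCommGroup M] [Module Coeff M] : AddCommGroup (Ext2 M) :=
  inferInstanceAs (AddCommGroup (⋀[Coeff]^2 M))

instance (M : Type u) [AddCommGroup M] [Module Coeff M] : Module Coeff (Ext2 M) :=
  inferInstanceAs (Module Coeff (⋀[Coeff]^2 M))

/-- The universal alternating map `M × M → ⋀² M`. -/
def Ext2.mk (M : Type u) [AddCommGroup M] [Module Coeff M] : M [⋀^Fin 2]→ₗ[Coeff] Ext2 M :=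
  exteriorPower.ιMulti Coeff 2

/-- `a ∧ b` in the exterior square. -/
def wedge {M : Type u} [AddCommGroup M] [Module Coeff M] (a b : M) : Ext2 M :=
  Ext2.mk M ![a, b]

/-- The linear map on exterior squares induced by `f`. -/
def Ext2.map {M N : Type u} [AddCommGroup M] [Module Coeff M] [AddCommGroup N] [Module Coeff N]
    (f : M →ₗ[Coeff] N) : Ext2 M →ₗ[Coeff] Ext2 N :=
  exteriorPower.map 2 f

section wedge
variable {M : Type u} [AddCommGroup M] [Module Coeff M]

theorem wedge_add_left (a a' b : M) : wedge (a + a') b = wedge a b + wedge a' b := by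
  have e : ∀ x : M, Function.update ![0, b] 0 x = ![x, b] := fun x => by
    ext j; fin_cases j <;> simp
  have h := (Ext2.mk M).map_update_add ![0, b] 0 a a'
  simp only [e] at h
  exact h

theorem wedge_add_right (a b b' : M) : wedge a (b + b') = wedge a b + wedge a b' := by
  have e : ∀ x : M, Function.update ![a, 0] 1 x = ![a, x] := fun x => by
    ext j; fin_cases j <;> simp
  have h := (Ext2.mk M).map_update_add ![a, 0] 1 b b'
  simp only [e] at h
  exact h

theorem wedge_smul_left (c : Coeff) (a b : M) : wedge (c • a) b = c • wedge a b := by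
  have e : ∀ x : M, Function.update ![0, b] 0 x = ![x, b] := fun x => by
    ext j; fin_cases j <;> simp
  have h := (Ext2.mk M).map_update_smul ![0, b] 0 c a
  simp only [e] at h
  exact h

theorem wedge_smul_right (c : Coeff) (a b : M) : wedge a (c • b) = c • wedge a b := by
  have e : ∀ x : M, Function.update ![a, 0] 1 x = ![a, x] := fun x => by
    ext j; fin_cases j <;> simp
  have h := (Ext2.mk M).map_update_smul ![a, 0] 1 c b
  simp only [e] at h
  exact h

theorem wedge_self (a : M) : wedge a a = 0 :=
  (Ext2.mk M).map_eq_zero_of_eq ![a, a] (i := 0) (j := 1)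
    (by simp) (by decide)

theorem wedge_zero_left (b : M) : wedge 0 b = 0 := by
  simpa using wedge_smul_left (0 : Coeff) (0 : M) b

theorem wedge_zero_right (a : M) : wedge a 0 = 0 := by
  simpa using wedge_smul_right (0 : Coeff) a (0 : M)

/-- `(a, b) ↦ a ∧ b` as a bilinear map. -/
def wedgeBilin (M : Type u) [AddCommGroup M] [Module Coeff M] :
    M →ₗ[Coeff] M →ₗ[Coeff] Ext2 M :=
  LinearMap.mk₂ Coeff wedge wedge_add_left wedge_smul_left wedge_add_right wedge_smul_right

theorem map_wedge {N : Type u} [AddCommGroup N] [Module Coeff N] (f : M →ₗ[Coeff] N) (a b : M) :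
    Ext2.map f (wedge a b) = wedge (f a) (f b) := by
  refine (exteriorPower.map_apply_ιMulti f ![a, b]).trans ?_
  refine congrArg (exteriorPower.ιMulti Coeff 2) ?_
  ext i
  fin_cases i <;> rfl

end wedge

section cls
variable {F : Type u} [Field F]

theorem cls_zero : cls (0 : F) = 0 := by simp [cls]

theorem cls_of_ne {x : F} (h : x ≠ 0) :
    cls x = unitCls (Units.mk0 x h) := by simp [cls, h]

theorem cls_mul {x y : F} (hx : x ≠ 0) (hy : y ≠ 0) : cls (x * y) = cls x + cls y := by
  rw [cls_of_ne hx, cls_of_ne hy, cls_of_ne (mul_ne_zero hx hy), ← unitCls_mul]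
  congr 1
  ext
  simp

theorem cls_one : cls (1 : F) = 0 := by
  have h := cls_mul (one_ne_zero (α := F)) one_ne_zero
  rw [mul_one] at h
  simpa using h

theorem cls_neg_one : cls (-1 : F) = 0 := by
  have h := cls_mul (neg_ne_zero.mpr (one_ne_zero (α := F)))
    (neg_ne_zero.mpr (one_ne_zero (α := F)))
  rw [neg_mul_neg, mul_one, cls_one, ← two_smul Coeff] at h
  exact (isUnit_two.smul_eq_zero).mp h.symm

theorem cls_neg (x : F) : cls (-x) = cls x := by
  rcases eq_or_ne x 0 with rfl | hx
  · simp
  · rw [← neg_one_mul, cls_mul (neg_ne_zero.mpr one_ne_zero) hx, cls_neg_one, zero_add]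

end cls

/-! ### Formal symbols on `ℤ[F]` -/

/-- The map `{x} ↦ (1 - x) ∧ x`, with `{0}, {1} ↦ 0`. -/
def formal2 (F : Type u) [Field F] : (F →₀ Coeff) →ₗ[Coeff] Ext2 (MulGrp F) :=
  Finsupp.linearCombination Coeff fun x : F => wedge (cls (1 - x)) (cls x)

/-- The map `{x} ↦ ((1 - x) ∧ x) ⊗ x`. -/
def formal3 (F : Type u) [Field F] :
    (F →₀ Coeff) →ₗ[Coeff] (Ext2 (MulGrp F)) ⊗[Coeff] MulGrp F :=
  Finsupp.linearCombination Coeff fun x : F => wedge (cls (1 - x)) (cls x) ⊗ₜ[Coeff] cls x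

open Classical in
/-- Specialization of `∑ nᵢ {fᵢ(t)}` at `t = a`; terms with a pole at `a` give `{∞} = 0`. -/
def specialize {F : Type u} [Field F] (a : F) :
    (RatFunc F →₀ Coeff) →ₗ[Coeff] (F →₀ Coeff) :=
  Finsupp.linearCombination Coeff fun f : RatFunc F =>
    if f.denom.eval a = 0 then 0 else Finsupp.single (f.eval (RingHom.id F) a) 1

/-! #### The leading coefficient at `t = a` of a rational function -/

section leading
variable {F : Type u} [Field F]

/-- The coefficient of the lowest power of `t - a` in a polynomial. -/
def polyLead (a : F) : Polynomial F →*₀ F where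
  toFun p := (Polynomial.taylor a p).trailingCoeff
  map_zero' := by simp
  map_one' := by simp [Polynomial.trailingCoeff]
  map_mul' p q := by rw [Polynomial.taylor_mul, Polynomial.trailingCoeff_mul]

theorem polyLead_ne_zero (a : F) {p : Polynomial F} (hp : p ≠ 0) : polyLead a p ≠ 0 := by
  intro h
  have h' : (Polynomial.taylor a p).trailingCoeff = 0 := h
  rw [Polynomial.trailingCoeff_eq_zero] at h'
  exact hp (Polynomial.taylor_injective a (by simpa using h'))

theorem polyLead_of_eval_ne_zero (a : F) {p : Polynomial F} (h : p.eval a ≠ 0) :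
    polyLead a p = p.eval a := by
  change (Polynomial.taylor a p).trailingCoeff = _
  have h0 : (Polynomial.taylor a p).coeff 0 ≠ 0 := by rwa [Polynomial.taylor_coeff_zero]
  rw [Polynomial.trailingCoeff, Polynomial.natTrailingDegree_eq_zero.mpr (Or.inr h0),
    Polynomial.taylor_coeff_zero]

/-- The leading coefficient at `t = a` of a rational function. -/
def lead (a : F) : RatFunc F →*₀ F :=
  RatFunc.liftMonoidWithZeroHom (polyLead a) (by
    intro p hp
    exact mem_nonZeroDivisors_of_ne_zero (polyLead_ne_zero a (nonZeroDivisors.ne_zero hp)))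

theorem lead_algebraMap (a : F) (p : Polynomial F) :
    lead a (algebraMap _ (RatFunc F) p) = polyLead a p := by
  have h := RatFunc.liftMonoidWithZeroHom_apply_ofFractionRing_mk (polyLead a) (by
    intro p hp
    exact mem_nonZeroDivisors_of_ne_zero (polyLead_ne_zero a (nonZeroDivisors.ne_zero hp))) p 1
  rw [Localization.mk_one_eq_algebraMap, RatFunc.ofFractionRing_algebraMap] at h
  rw [lead, h]
  simp

theorem lead_eq (a : F) (f : RatFunc F) : lead a f = polyLead a f.num / polyLead a f.denom := by
  conv_lhs => rw [← RatFunc.num_div_denom f]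
  rw [map_div₀, lead_algebraMap, lead_algebraMap]

theorem one_sub_eq (f : RatFunc F) :
    1 - f = algebraMap _ (RatFunc F) (f.denom - f.num) / algebraMap _ (RatFunc F) f.denom := by
  have hd : algebraMap _ (RatFunc F) f.denom ≠ 0 := RatFunc.algebraMap_ne_zero f.denom_ne_zero
  rw [map_sub, sub_div, div_self hd, RatFunc.num_div_denom]

theorem lead_one_sub (a : F) (f : RatFunc F) :
    lead a (1 - f) = polyLead a (f.denom - f.num) / polyLead a f.denom := by
  rw [one_sub_eq, map_div₀, lead_algebraMap, lead_algebraMap]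

theorem eval_num_ne_zero (a : F) (f : RatFunc F) (h : f.denom.eval a = 0) :
    f.num.eval a ≠ 0 := by
  intro h'
  obtain ⟨u, v, e⟩ := RatFunc.isCoprime_num_denom f
  have := congrArg (Polynomial.eval a) e
  simp [h, h'] at this

/-- The map on multiplicative groups that `lead a` induces. -/
def leadMap (a : F) : MulGrp (RatFunc F) →ₗ[Coeff] MulGrp F :=
  LinearMap.baseChange Coeff
    (MonoidHom.toAdditive (Units.map (lead a : RatFunc F →* F))).toIntLinearMap

theorem leadMap_unitCls (a : F) (u : (RatFunc F)ˣ) :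
    leadMap a (unitCls u) = unitCls (Units.map (lead a : RatFunc F →* F) u) :=
  LinearMap.baseChange_tmul _ _ _

theorem leadMap_cls (a : F) (f : RatFunc F) : leadMap a (cls f) = cls (lead a f) := by
  rcases eq_or_ne f 0 with rfl | hf
  · rw [map_zero, cls_zero, cls_zero, map_zero]
  · rw [cls_of_ne hf, cls_of_ne ((map_ne_zero (lead a)).mpr hf), leadMap_unitCls]
    congr 1
    ext
    rfl

/-- Either the symbol degenerates on both sides, or `f(a)` is the leading coefficient. -/
theorem lead_cases (a : F) (f : RatFunc F) :
    (wedge (cls (lead a (1 - f))) (cls (lead a f)) = 0 ∧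
      (f.denom.eval a = 0 ∨ f.eval (RingHom.id F) a = 0 ∨ f.eval (RingHom.id F) a = 1)) ∨
    (f.denom.eval a ≠ 0 ∧ lead a f = f.eval (RingHom.id F) a ∧
      lead a (1 - f) = 1 - f.eval (RingHom.id F) a) := by
  by_cases hd : f.denom.eval a = 0
  · refine Or.inl ⟨?_, Or.inl hd⟩
    have hn := eval_num_ne_zero a f hd
    have hs : (f.denom - f.num).eval a ≠ 0 := by simpa [hd] using hn
    have e : lead a (1 - f) = -lead a f := by
      rw [lead_one_sub, lead_eq, polyLead_of_eval_ne_zero a hs, polyLead_of_eval_ne_zero a hn]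
      simp [hd, neg_div]
    rw [e, cls_neg, wedge_self]
  · have hev : f.eval (RingHom.id F) a = f.num.eval a / f.denom.eval a := by
      simp [RatFunc.eval, Polynomial.eval₂_id]
    by_cases hn : f.num.eval a = 0
    · refine Or.inl ⟨?_, Or.inr (Or.inl (by rw [hev, hn, zero_div]))⟩
      have hs : (f.denom - f.num).eval a ≠ 0 := by simpa [hn] using hd
      have e : lead a (1 - f) = 1 := by
        rw [lead_one_sub, polyLead_of_eval_ne_zero a hs, polyLead_of_eval_ne_zero a hd]
        simp [hn, hd]
      rw [e, cls_one, wedge_zero_left]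
    · have e1 : lead a f = f.eval (RingHom.id F) a := by
        rw [lead_eq, polyLead_of_eval_ne_zero a hn, polyLead_of_eval_ne_zero a hd, hev]
      by_cases hs : (f.denom - f.num).eval a = 0
      · have h1 : f.eval (RingHom.id F) a = 1 := by
          rw [Polynomial.eval_sub, sub_eq_zero] at hs
          rw [hev, hs, div_self hn]
        exact Or.inl ⟨by rw [e1, h1, cls_one, wedge_zero_right], Or.inr (Or.inr h1)⟩
      · refine Or.inr ⟨hd, e1, ?_⟩
        rw [lead_one_sub, polyLead_of_eval_ne_zero a hs, polyLead_of_eval_ne_zero a hd, hev,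
          Polynomial.eval_sub, sub_div, div_self hd]

theorem formal2_single (x : F) :
    formal2 F (Finsupp.single x 1) = wedge (cls (1 - x)) (cls x) := by
  simp [formal2]

theorem formal3_single (x : F) :
    formal3 F (Finsupp.single x 1) = wedge (cls (1 - x)) (cls x) ⊗ₜ[Coeff] cls x := by
  simp [formal3]

open Classical in
theorem specialize_single (a : F) (f : RatFunc F) :
    specialize a (Finsupp.single f 1) =
      if f.denom.eval a = 0 then 0 else Finsupp.single (f.eval (RingHom.id F) a) 1 := by
  rw [specialize, Finsupp.linearCombination_single, one_smul]

theorem formal2_specialize (a : F) :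
    (formal2 F) ∘ₗ (specialize a) = (Ext2.map (leadMap a)) ∘ₗ formal2 (RatFunc F) := by
  refine Finsupp.lhom_ext' fun f => LinearMap.ext_ring ?_
  simp only [LinearMap.comp_apply, Finsupp.lsingle_apply]
  rw [formal2_single, map_wedge, leadMap_cls, leadMap_cls, specialize_single]
  rcases lead_cases a f with ⟨h, h'⟩ | ⟨h, h1, h2⟩
  · rw [h]
    split_ifs with hd
    · simp
    · rw [formal2_single]
      rcases h' with h' | h' | h'
      · exact absurd h' hd
      · rw [h', cls_zero, wedge_zero_right]
      · rw [h', sub_self, cls_zero, wedge_zero_left]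
  · rw [if_neg h, formal2_single, h1, h2]

theorem formal3_specialize (a : F) :
    (formal3 F) ∘ₗ (specialize a) =
      (TensorProduct.map (Ext2.map (leadMap a)) (leadMap a)) ∘ₗ
        formal3 (RatFunc F) := by
  refine Finsupp.lhom_ext' fun f => LinearMap.ext_ring ?_
  simp only [LinearMap.comp_apply, Finsupp.lsingle_apply]
  rw [formal3_single, TensorProduct.map_tmul, map_wedge, leadMap_cls, leadMap_cls,
    specialize_single]
  rcases lead_cases a f with ⟨h, h'⟩ | ⟨h, h1, h2⟩
  · rw [h, TensorProduct.zero_tmul]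
    split_ifs with hd
    · simp
    · rw [formal3_single]
      rcases h' with h' | h' | h'
      · exact absurd h' hd
      · rw [h', cls_zero, TensorProduct.tmul_zero]
      · rw [h', cls_one, TensorProduct.tmul_zero]
  · rw [if_neg h, formal3_single, h1, h2]

end leading

/-! ### The higher Bloch groups `B₂(F)` and `B₃(F)`

`Bₙ(F) = ℤ[F] / Rₙ(F)`, where `Rₙ(F)` is spanned by `{0}` (and `{∞}`, which is set to `0`
throughout) and by the differences `α(0) - α(1)`, where `α = ∑ nᵢ {fᵢ(t)}` runs through the
kernel `Aₙ(F(t))` of the coboundary `δₙ` over the rational function field `F(t)`; here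
`δ₂ {x} = (1 - x) ∧ x` in `⋀² F^×` and `δ₃ {x} = {x}₂ ⊗ x` in `B₂(F) ⊗ F^×`. -/

/-- The relations `R₂(F)`: functional equations of the dilogarithm. -/
def R2 (F : Type u) [Field F] : Submodule Coeff (F →₀ Coeff) :=
  Submodule.span Coeff ({Finsupp.single 0 1} ∪
    {β | ∃ α ∈ LinearMap.ker (formal2 (RatFunc F)), β = specialize 0 α - specialize 1 α})

/-- The group `B₂(F)` (tensored with `ℤ[1/7!]`). -/
def B2 (F : Type u) [Field F] : Type u := (F →₀ Coeff) ⧸ R2 F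

instance (F : Type u) [Field F] : AddCommGroup (B2 F) :=
  inferInstanceAs (AddCommGroup ((F →₀ Coeff) ⧸ R2 F))

instance (F : Type u) [Field F] : Module Coeff (B2 F) :=
  inferInstanceAs (Module Coeff ((F →₀ Coeff) ⧸ R2 F))

/-- The generator `{x}₂`. -/
def gen2 {F : Type u} [Field F] (x : F) : B2 F := (R2 F).mkQ (Finsupp.single x 1)

/-- The coboundary `δ₃ : ℤ[F] → B₂(F) ⊗ F^×`, `{x} ↦ {x}₂ ⊗ x`. -/
def delta3 (F : Type u) [Field F] : (F →₀ Coeff) →ₗ[Coeff] B2 F ⊗[Coeff] MulGrp F :=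
  Finsupp.linearCombination Coeff fun x : F => gen2 x ⊗ₜ[Coeff] cls x

/-- The relations `R₃(F)`: functional equations of the trilogarithm. -/
def R3 (F : Type u) [Field F] : Submodule Coeff (F →₀ Coeff) :=
  Submodule.span Coeff ({Finsupp.single 0 1} ∪
    {β | ∃ α ∈ LinearMap.ker (delta3 (RatFunc F)), β = specialize 0 α - specialize 1 α})

/-- The group `B₃(F)` (tensored with `ℤ[1/7!]`). -/
def B3 (F : Type u) [Field F] : Type u := (F →₀ Coeff) ⧸ R3 F

instance (F : Type u) [Field F] : AddCommGroup (B3 F) :=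
  inferInstanceAs (AddCommGroup ((F →₀ Coeff) ⧸ R3 F))

instance (F : Type u) [Field F] : Module Coeff (B3 F) :=
  inferInstanceAs (Module Coeff ((F →₀ Coeff) ⧸ R3 F))

/-- The generator `{x}₃`. -/
def gen3 {F : Type u} [Field F] (x : F) : B3 F := (R3 F).mkQ (Finsupp.single x 1)

theorem R2_le_ker (F : Type u) [Field F] : R2 F ≤ LinearMap.ker (formal2 F) := by
  refine Submodule.span_le.mpr ?_
  rintro β (hβ | ⟨α, hα, rfl⟩)
  · rw [Set.mem_singleton_iff] at hβ
    subst hβ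
    simp [formal2_single, cls_zero, wedge_zero_right]
  · have h : ∀ a : F, formal2 F (specialize a α) = 0 := fun a => by
      rw [← LinearMap.comp_apply, formal2_specialize, LinearMap.comp_apply,
        LinearMap.mem_ker.mp hα, map_zero]
    simp [h]

/-- The symbol on `B₂(F)`: `{x}₂ ↦ (1 - x) ∧ x`. -/
def symbol2 (F : Type u) [Field F] : B2 F →ₗ[Coeff] Ext2 (MulGrp F) :=
  (R2 F).liftQ (formal2 F) (R2_le_ker F)

theorem symbol2_gen2 {F : Type u} [Field F] (x : F) :
    symbol2 F (gen2 x) = wedge (cls (1 - x)) (cls x) := by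
  refine ((R2 F).liftQ_apply (formal2 F) (Finsupp.single x 1)).trans ?_
  rw [formal2_single]

theorem formal3_eq (F : Type u) [Field F] :
    formal3 F = (symbol2 F).rTensor (MulGrp F) ∘ₗ delta3 F := by
  refine Finsupp.lhom_ext' fun x => LinearMap.ext_ring ?_
  simp [formal3, delta3, symbol2_gen2]

theorem R3_le_ker (F : Type u) [Field F] : R3 F ≤ LinearMap.ker (formal3 F) := by
  refine Submodule.span_le.mpr ?_
  rintro β (hβ | ⟨α, hα, rfl⟩)
  · rw [Set.mem_singleton_iff] at hβ
    subst hβ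
    simp [formal3_single, cls_zero]
  · have h : ∀ a : F, formal3 F (specialize a α) = 0 := fun a => by
      rw [← LinearMap.comp_apply, formal3_specialize, LinearMap.comp_apply, formal3_eq,
        LinearMap.comp_apply, LinearMap.mem_ker.mp hα, map_zero, map_zero]
    simp [h]

/-- The symbol on `B₃(F)`: `{x}₃ ↦ ((1 - x) ∧ x) ⊗ x`. -/
def symbol3 (F : Type u) [Field F] :
    B3 F →ₗ[Coeff] (Ext2 (MulGrp F)) ⊗[Coeff] MulGrp F :=
  (R3 F).liftQ (formal3 F) (R3_le_ker F)

theorem symbol3_gen3 {F : Type u} [Field F] (x : F) :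
    symbol3 F (gen3 x) = wedge (cls (1 - x)) (cls x) ⊗ₜ[Coeff] cls x := by
  refine ((R3 F).liftQ_apply (formal3 F) (Finsupp.single x 1)).trans ?_
  rw [formal3_single]

/-! ### The symbol `S` and the cobracket `δ` in weight four -/

/-- The group `(B₃(F) ⊗ F^×) ⊕ ⋀² B₂(F)`. -/
abbrev Target (F : Type u) [Field F] : Type u :=
  (B3 F ⊗[Coeff] MulGrp F) × Ext2 (B2 F)

/-- The group of symbols: tensors `(a ∧ b) ⊗ c ⊗ d` and `(a ∧ b) ∧ (c ∧ d)`. -/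
abbrev Symbols (F : Type u) [Field F] : Type u :=
  ((Ext2 (MulGrp F) ⊗[Coeff] MulGrp F) ⊗[Coeff] MulGrp F) ×
    Ext2 (Ext2 (MulGrp F))

/-- The symbol `S`: `{a}₃ ⊗ b ↦ ((1 - a) ∧ a) ⊗ a ⊗ b` and
`{a}₂ ∧ {b}₂ ↦ ((1 - a) ∧ a) ∧ ((1 - b) ∧ b)`. -/
def S (F : Type u) [Field F] : Target F →ₗ[Coeff] Symbols F :=
  LinearMap.prodMap ((symbol3 F).rTensor (MulGrp F)) (Ext2.map (symbol2 F))

/-- The cobracket component `δ` with values in the exterior square of the weight two part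
`⋀² F^×`: it sends `(a ∧ b) ⊗ c ⊗ d` to `(a ∧ b) ∧ (c ∧ d)`, i.e. it alternates in the first two
slots, in the last two slots and under the exchange of these two pairs of slots. Elements
`(a ∧ b) ∧ (c ∧ d)`, which have been alternated already, are left unchanged. -/
def cobracket (F : Type u) [Field F] :
    Symbols F →ₗ[Coeff] Ext2 (Ext2 (MulGrp F)) :=
  LinearMap.coprod
    (TensorProduct.lift (wedgeBilin (Ext2 (MulGrp F))) ∘ₗ
      LinearMap.lTensor (Ext2 (MulGrp F)) (TensorProduct.lift (wedgeBilin (MulGrp F))) ∘ₗ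
      (TensorProduct.assoc Coeff (Ext2 (MulGrp F)) (MulGrp F) (MulGrp F)).toLinearMap)
    LinearMap.id

/-! ### Configurations -/

/-- The determinant `(i j k l) = |vᵢ vⱼ vₖ vₗ|`. -/
def det4 {F : Type u} [Field F] {N : ℕ} (v : Fin N → Fin 4 → F) (i j k l : Fin N) : F :=
  Matrix.det (Matrix.of ![v i, v j, v k, v l]).transpose

/-- General position in `F⁴`: any four of the vectors are linearly independent. -/
def GeneralPosition {F : Type u} [Field F] {N : ℕ} (v : Fin N → Fin 4 → F) : Prop :=
  ∀ s : Fin 4 → Fin N, Function.Injective s → LinearIndependent F (v ∘ s)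

/-- Representatives of configurations of `N` points: `N` vectors in `F⁴` in general position. -/
def Conf (F : Type u) [Field F] (N : ℕ) : Type u :=
  {v : Fin N → Fin 4 → F // GeneralPosition v}

/-- The free module on the representatives of configurations. -/
abbrev Chains (F : Type u) [Field F] (N : ℕ) : Type u := Conf F N →₀ Coeff

/-- Leaving out the `i`-th vector. -/
def Conf.face {F : Type u} [Field F] {N : ℕ} (v : Conf F (N + 1)) (i : Fin (N + 1)) : Conf F N :=
  ⟨v.1 ∘ i.succAbove, fun s hs =>
    v.2 (i.succAbove ∘ s) (Fin.succAbove_right_injective.comp hs)⟩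

/-- The differential `d`: the alternating sum over the vectors that are left out. -/
def d (F : Type u) [Field F] (N : ℕ) : Chains F (N + 1) →ₗ[Coeff] Chains F N :=
  Finsupp.linearCombination Coeff fun v : Conf F (N + 1) =>
    ∑ i : Fin (N + 1), (-1 : Coeff) ^ (i : ℕ) • Finsupp.single (v.face i) (1 : Coeff)

/-- The projected cross ratio `(i₁ i₂ | i₃ i₄ i₅ i₆)`. -/
def crossRatio {F : Type u} [Field F] {N : ℕ} (v : Fin N → Fin 4 → F)
    (i₁ i₂ i₃ i₄ i₅ i₆ : Fin N) : F :=
  (det4 v i₁ i₂ i₃ i₅ * det4 v i₁ i₂ i₄ i₆) / (det4 v i₁ i₂ i₃ i₆ * det4 v i₁ i₂ i₄ i₅)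

/-- The projected triple ratio `(i₁ | i₂ i₃ i₄ i₅ i₆ i₇)`. -/
def tripleRatio {F : Type u} [Field F] {N : ℕ} (v : Fin N → Fin 4 → F)
    (i₁ i₂ i₃ i₄ i₅ i₆ i₇ : Fin N) : F :=
  (det4 v i₁ i₂ i₃ i₅ * det4 v i₁ i₃ i₄ i₆ * det4 v i₁ i₄ i₂ i₇) /
    (det4 v i₁ i₂ i₃ i₆ * det4 v i₁ i₃ i₄ i₇ * det4 v i₁ i₄ i₂ i₅)

/-- The alternation `Alt_N` (without division by `N!`) of an expression in `N` vectors. -/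
def Alt {F : Type u} [Field F] {M : Type u} [AddCommGroup M] {N : ℕ}
    (f : (Fin N → Fin 4 → F) → M) (v : Fin N → Fin 4 → F) : M :=
  ∑ σ : Equiv.Perm (Fin N), (Equiv.Perm.sign σ : ℤ) • f (v ∘ σ)

/-! ### The maps of the theorem; the points `1, …, N` are indexed by `0, …, N - 1` -/

/-- `f₃₁ = Alt₇ ((1 | 2 3 4 5 6 7)₃ ⊗ (2 3 5 6))`. -/
def f31 {F : Type u} [Field F] (v : Fin 7 → Fin 4 → F) : B3 F ⊗[Coeff] MulGrp F :=
  Alt (fun w : Fin 7 → Fin 4 → F =>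
    gen3 (tripleRatio w 0 1 2 3 4 5 6) ⊗ₜ[Coeff] cls (det4 w 1 2 4 5)) v

/-- `f₂₂ = Alt₇ ((1 2 | 3 4 5 6)₂ ∧ (3 4 | 1 2 5 7)₂)`. -/
def f22 {F : Type u} [Field F] (v : Fin 7 → Fin 4 → F) : Ext2 (B2 F) :=
  Alt (fun w : Fin 7 → Fin 4 → F =>
    wedge (gen2 (crossRatio w 0 1 2 3 4 5)) (gen2 (crossRatio w 2 3 0 1 4 6))) v

/-- `f₇(4) = 3/7 f₂₂ + 2 f₃₁`. -/
def f7 (F : Type u) [Field F] : Chains F 7 →ₗ[Coeff] Target F :=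
  Finsupp.linearCombination Coeff fun v : Conf F 7 =>
    ((2 : Coeff) • f31 v.1, threeSevenths • f22 v.1)

/-- `Alt₈ (28 ((1 | 2 3 4 5 6 7)₃ ⊗ (1 2 5 8)) - 6 ((8 1 | 2 3 4 5)₂ ∧ (8 2 | 1 5 6 7)₂))`. -/
def dualCombination {F : Type u} [Field F] (v : Fin 8 → Fin 4 → F) : Target F :=
  Alt (fun w : Fin 8 → Fin 4 → F =>
    ((28 : Coeff) • (gen3 (tripleRatio w 0 1 2 3 4 5 6) ⊗ₜ[Coeff] cls (det4 w 0 1 4 7)),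
      -((6 : Coeff) • wedge (gen2 (crossRatio w 7 0 1 2 3 4))
        (gen2 (crossRatio w 7 1 0 4 5 6))))) v

/-- Eight vectors `w` are dual to `v`: each determinant of four of the vectors `w` is, up to the
sign of the permutation, the determinant of the four complementary vectors of `v`. -/
def IsDual {F : Type u} [Field F] (v w : Fin 8 → Fin 4 → F) : Prop :=
  ∀ σ : Equiv.Perm (Fin 8),
    det4 w (σ 0) (σ 1) (σ 2) (σ 3) =
      ((Equiv.Perm.sign σ : ℤ) : F) * det4 v (σ 4) (σ 5) (σ 6) (σ 7)

end Weight4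

end

namespace Weight4

universe u

/-! ### Formal monomials in brackets -/

/-! Since -1 has class 0, a bracket depends only on its set of four points. Cross-ratios, triple
ratios and one minus a cross-ratio are quotients of products of brackets by the Plücker relation;
one minus a triple ratio involves in addition one concurrency determinant (`tripleRatio_one_sub`).
By bilinearity, δ(S(Θ)) is therefore a combination of alternations of monomials (a ∧ b) ∧ (c ∧ d) in
these letters.

An alternation over 𝔖₈ sees a monomial only up to relabelling. If an odd permutation fixes the
monomial, its alternation equals its own negative and vanishes, because 2 is invertible; this
removes every monomial with a concurrency determinant. All the others either vanish in the same way
or are, up to sign, relabellings of the single monomial `Mono.strip` (`Mono.alt_eq_stripCoeff`). A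
finite computation finds the coefficient 6 for the B₃ ⊗ F^× term and 28 for the ⋀² B₂ term
(`totalCoeff_tripleTerms`, `totalCoeff_crossTerms`), and 28 · 6 - 6 · 28 = 0.

For the comparison with f₇(4) ∘ d, composing with d turns an alternation over seven points into one
over eight (`Alt_comp_succ`). Duality replaces each bracket by the complementary one. With points 0,
…, 7, the triple ratio (0 | 1 2 3 4 5 6) of w becomes (7 | 6 5 4 3 2 1) of v, and the cross-ratio (0
1 | 2 3 4 5) becomes (6 7 | 2 3 4 5). After relabelling, only the order of the arguments of the
cross-ratios differs, and this is absorbed by {1/x}₂ = {1 - x}₂ = -{x}₂, which is derived here from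
the definition of B₂. Finally, every configuration in general position has a dual (`exists_isDual`)
and 14 is invertible, so the vanishing for Θ gives the vanishing for f₇(4) ∘ d. -/

/-- Formal letters: the brackets `(i j k l)`, and the condition `conc p a a' b b' c c'` that the
lines `aa'`, `bb'`, `cc'` are concurrent after projection from the point `p`. -/
inductive Letter : Type
  | br (i j k l : Fin 8)
  | conc (p a a' b b' c c' : Fin 8)

namespace Letter

/-- Relabelling of the points. -/
def map (σ : Fin 8 → Fin 8) : Letter → Letter
  | br i j k l => br (σ i) (σ j) (σ k) (σ l)
  | conc p a a' b b' c c' => conc (σ p) (σ a) (σ a') (σ b) (σ b') (σ c) (σ c')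

/-- Equality up to the evident symmetries of the letters. -/
def equiv : Letter → Letter → Bool
  | br i j k l, br i' j' k' l' => [i, j, k, l].isPerm [i', j', k', l']
  | conc p a a' b b' c c', conc q d d' e e' f f' =>
      p == q && ((a == d && a' == d') || (a == d' && a' == d)) &&
        ((b == e && b' == e') || (b == e' && b' == e)) &&
        ((c == f && c' == f') || (c == f' && c' == f))
  | _, _ => false

end Letter

/-- The sign `±1` by which the wedge products of two pairs of letters differ, and `0` if they are
not visibly proportional. -/
def pairSign (x y : Letter × Letter) : ℤ :=
  if x.1.equiv y.1 && x.2.equiv y.2 then 1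
  else if x.1.equiv y.2 && x.2.equiv y.1 then -1 else 0

/-- The formal monomial `(a ∧ b) ∧ (c ∧ d)`. -/
abbrev Mono : Type := (Letter × Letter) × (Letter × Letter)

namespace Mono

/-- Relabelling of the points. -/
def map (σ : Fin 8 → Fin 8) (m : Mono) : Mono :=
  ((m.1.1.map σ, m.1.2.map σ), (m.2.1.map σ, m.2.2.map σ))

/-- The sign `±1` by which two monomials differ, and `0` if they are not visibly proportional. -/
def relSign (m n : Mono) : ℤ :=
  let s := pairSign m.1 n.1 * pairSign m.2 n.2
  if s = 0 then -(pairSign m.1 n.2 * pairSign m.2 n.1) else s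

/-- The action of a product of transpositions. -/
def act (l : List (Fin 8 × Fin 8)) (m : Mono) : Mono :=
  l.foldr (fun t n => n.map (Equiv.swap t.1 t.2)) m

/-- The strip of triangles `5 3 2`, `3 2 1`, `2 1 4`, `1 4 7`, coned off from the point `0`. -/
def strip : Mono :=
  ((.br 0 1 2 3, .br 0 2 3 5), (.br 0 1 2 4, .br 0 1 4 7))

/-- Odd symmetries of the monomials whose alternation vanishes. -/
def oddWords : List (List (Fin 8 × Fin 8)) :=
  [[], [(4, 7)], [(3, 6)], [(2, 5)], [(1, 7)], [(0, 7)], [(1, 4)], [(0, 1)], [(1, 5)], [(1, 6)],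
    [(2, 6)], [(3, 5)], [(0, 2)], [(0, 3)], [(5, 6)],
    [(1, 2), (3, 4), (5, 7)], [(1, 2), (3, 4), (6, 7)], [(1, 3), (2, 4), (5, 7)],
    [(1, 3), (2, 4), (6, 7)], [(1, 2), (3, 7), (4, 5)], [(1, 3), (2, 7), (4, 6)]]

/-- Permutations that carry `strip` to the other monomials whose alternation survives. -/
def stripWords : List (List (Fin 8 × Fin 8)) :=
  [[], [(2, 3)], [(3, 5)], [(5, 6)], [(2, 3), (5, 6)], [(2, 3), (3, 6), (5, 6)]] ++
  -- The words above keep the cone point 0 and the bracket 0147, as the triple ratio terms require.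
  -- In those below, the final (0 7), which is applied last, moves the cone point to 7, the point
  -- common to all brackets of the cross-ratio terms.
  ([[(1, 4), (2, 4), (3, 6), (4, 7)],
    [(1, 4), (2, 7), (5, 7)],
    [(1, 4), (2, 7), (5, 7), (6, 7)],
    [(1, 7), (2, 4), (3, 7)],
    [(1, 7), (2, 4), (3, 7), (5, 6)],
    [(1, 7), (2, 7), (3, 5), (5, 6)],
    [(1, 7), (2, 7), (3, 6)],
    [(1, 7), (2, 7), (3, 6), (4, 7)],
    [(1, 7), (2, 7), (3, 6), (6, 7)],
    [(2, 4), (3, 7), (4, 5), (5, 7), (6, 7)],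
    [(2, 4), (3, 7), (4, 5), (6, 7)],
    [(2, 4), (3, 7), (4, 6), (5, 7)],
    [(2, 7), (3, 4), (4, 5), (6, 7)],
    [(2, 7), (3, 7), (4, 5), (5, 7)],
    [(2, 7), (3, 7), (4, 5), (5, 7), (6, 7)],
    [(2, 7), (3, 7), (4, 5), (6, 7)],
    [(2, 7), (3, 7), (4, 6), (5, 7)],
    [(2, 7), (3, 7), (4, 6), (5, 7), (6, 7)],
    [(2, 7), (3, 7), (5, 7)],
    [(2, 7), (3, 7), (5, 7), (6, 7)],
    [(2, 7), (4, 5), (5, 7)],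
    [(2, 7), (4, 5), (5, 7), (6, 7)],
    [(2, 7), (4, 5), (6, 7)],
    [(2, 7), (4, 6), (5, 6), (6, 7)],
    [(2, 7), (4, 6), (5, 7)],
    [(2, 7), (4, 6), (5, 7), (6, 7)],
    [(2, 7), (5, 7)],
    [(2, 7), (5, 7), (6, 7)]] : List (List (Fin 8 × Fin 8))).map ((0, 7) :: ·)

/-- The multiple of the alternation of `strip` that the alternation of a monomial is, if this is
detected by the permutations listed above. -/
def stripCoeff (m : Mono) : Option ℤ :=
  if oddWords.any (fun l => relSign (m.act l) m == -(-1) ^ l.length) then some 0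
  else (stripWords.find? fun l => relSign m (strip.act l) != 0).map fun l =>
    relSign m (strip.act l) * (-1) ^ l.length

end Mono

/-- Formal linear combinations of letters. -/
abbrev Form : Type := List (ℤ × Letter)

/-- The negative of a linear combination. -/
def Form.neg (A : Form) : Form := A.map fun t => (-t.1, t.2)

/-- The pairs of letters in `A ∧ B`. -/
def Form.wedge (A B : Form) : List (ℤ × (Letter × Letter)) :=
  A.flatMap fun a => B.map fun b => (a.1 * b.1, (a.2, b.2))

/-- The monomials in `P ∧ Q`. -/
def expand (P Q : List (ℤ × (Letter × Letter))) : List (ℤ × Mono) :=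
  P.flatMap fun p => Q.map fun q => (p.1 * q.1, (p.2, q.2))

/-- The pairs of letters in `(1 - r) ∧ r`, where `r` has numerator `N` and denominator `D` and
`1 - r` has numerator `A`. -/
def Form.bloch (A N D : Form) : List (ℤ × (Letter × Letter)) :=
  Form.wedge (A ++ D.neg) N ++ Form.wedge A D.neg

/-- The coefficient of the alternation of `Mono.strip` in the alternation of a sum of monomials. -/
def totalCoeff (L : List (ℤ × Mono)) : Option ℤ :=
  L.foldr (fun t s => t.2.stripCoeff.bind fun n => s.map fun k => t.1 * n + k) (some 0)

/-! ### The two ratios as formal combinations of letters, and the finite computation -/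

/-- Numerator of the cross-ratio. -/
def crNum (a b i j k l : Fin 8) : Form := [(1, .br a b i k), (1, .br a b j l)]
/-- Denominator of the cross-ratio. -/
def crDen (a b i j k l : Fin 8) : Form := [(1, .br a b i l), (1, .br a b j k)]
/-- Numerator of one minus the cross-ratio. -/
def crOne (a b i j k l : Fin 8) : Form := [(1, .br a b i j), (1, .br a b k l)]
/-- Numerator of the triple ratio. -/
def trNum (a b c d e f g : Fin 8) : Form := [(1, .br a b c e), (1, .br a c d f), (1, .br a d b g)]
/-- Denominator of the triple ratio. -/
def trDen (a b c d e f g : Fin 8) : Form := [(1, .br a b c f), (1, .br a c d g), (1, .br a d b e)]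
/-- Numerator of one minus the triple ratio. -/
def trOne (a b c d e f g : Fin 8) : Form := [(1, .br a b c d), (1, .conc a b e c f d g)]

/-- The monomials of the `B₃ ⊗ F^×` part. -/
def tripleTerms : List (ℤ × Mono) :=
  expand (Form.bloch (trOne 0 1 2 3 4 5 6) (trNum 0 1 2 3 4 5 6) (trDen 0 1 2 3 4 5 6))
    (Form.wedge (trNum 0 1 2 3 4 5 6 ++ (trDen 0 1 2 3 4 5 6).neg) [(1, .br 0 1 4 7)])

/-- The monomials of the `⋀² B₂` part. -/
def crossTerms : List (ℤ × Mono) :=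
  expand (Form.bloch (crOne 7 0 1 2 3 4) (crNum 7 0 1 2 3 4) (crDen 7 0 1 2 3 4))
    (Form.bloch (crOne 7 1 0 4 5 6) (crNum 7 1 0 4 5 6) (crDen 7 1 0 4 5 6))

/-- The value `some` certifies that every monomial has been classified. Those with the concurrency
letter vanish for a visible reason: the transpositions (1 4), (2 5), (3 6) all fix that letter and
0147, and each of the six brackets of the triple ratio is moved by only one of them, so any two
brackets are fixed by a common one. -/
theorem totalCoeff_tripleTerms : totalCoeff tripleTerms = some 6 := by decide +kernel

theorem totalCoeff_crossTerms : totalCoeff crossTerms = some 28 := by decide +kernel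

/-! ### Alternation over the symmetric group -/

section Alt
variable {F : Type u} [Field F] {M M' : Type u} [AddCommGroup M] [AddCommGroup M'] {N : ℕ}

theorem Alt_congr {f g : (Fin N → Fin 4 → F) → M} {v w : Fin N → Fin 4 → F}
    (h : ∀ σ : Equiv.Perm (Fin N), f (v ∘ σ) = g (w ∘ σ)) : Alt f v = Alt g w :=
  Finset.sum_congr rfl fun σ _ => by rw [h]

/-- Substituting σ ↦ στ in the sum. This is what makes the alternation of a monomial insensitive, up
to sign, to the names of the points. -/
theorem Alt_comp_perm (f : (Fin N → Fin 4 → F) → M) (v : Fin N → Fin 4 → F)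
    (τ : Equiv.Perm (Fin N)) :
    Alt (fun w => f (w ∘ τ)) v = (Equiv.Perm.sign τ : ℤ) • Alt f v := by
  rw [Alt, Alt, Finset.smul_sum]
  refine Fintype.sum_equiv (Equiv.mulRight τ) _ _ fun σ => ?_
  have e : v ∘ ⇑((Equiv.mulRight τ) σ) = (v ∘ σ) ∘ τ := rfl
  rw [e, Equiv.coe_mulRight, Equiv.Perm.sign_mul, smul_smul]
  congr 1
  rcases Int.units_eq_one_or (Equiv.Perm.sign τ) with h | h <;> simp [h]

theorem Alt_add (f g : (Fin N → Fin 4 → F) → M) (v : Fin N → Fin 4 → F) :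
    Alt (fun w => f w + g w) v = Alt f v + Alt g v := by
  simp only [Alt, smul_add, Finset.sum_add_distrib]

theorem map_Alt (φ : M →+ M') (f : (Fin N → Fin 4 → F) → M) (v : Fin N → Fin 4 → F) :
    φ (Alt f v) = Alt (fun w => φ (f w)) v := by
  simp only [Alt, map_sum, map_zsmul]

theorem Alt_zsmul (c : ℤ) (f : (Fin N → Fin 4 → F) → M) (v : Fin N → Fin 4 → F) :
    Alt (fun w => c • f w) v = c • Alt f v := by
  simp only [Alt, Finset.smul_sum, smul_comm c]

theorem Alt_smul [Module Coeff M] (c : Coeff) (f : (Fin N → Fin 4 → F) → M)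
    (v : Fin N → Fin 4 → F) : Alt (fun w => c • f w) v = c • Alt f v := by
  simp only [Alt, Finset.smul_sum, smul_comm c]

theorem Alt_prodMk (f : (Fin N → Fin 4 → F) → M) (g : (Fin N → Fin 4 → F) → M')
    (v : Fin N → Fin 4 → F) : Alt (fun w => (f w, g w)) v = (Alt f v, Alt g v) := by
  refine Prod.ext ?_ ?_
  · simp [Alt, Prod.fst_sum]
  · simp [Alt, Prod.snd_sum]

theorem Alt_zero (v : Fin N → Fin 4 → F) : Alt (fun _ => (0 : M)) v = 0 := by
  simp [Alt]

end Alt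

/-! ### Brackets: antisymmetry, Plücker relation, nonvanishing -/

section det4
variable {F : Type u} [Field F] {N : ℕ} (v : Fin N → Fin 4 → F)

theorem det4_swap₁₂ (i j k l : Fin N) : det4 v j i k l = -det4 v i j k l := by
  simp [det4, Matrix.det_succ_row_zero, Fin.sum_univ_succ, Fin.succAbove]
  ring

theorem det4_swap₂₃ (i j k l : Fin N) : det4 v i k j l = -det4 v i j k l := by
  simp [det4, Matrix.det_succ_row_zero, Fin.sum_univ_succ, Fin.succAbove]
  ring

theorem det4_swap₃₄ (i j k l : Fin N) : det4 v i j l k = -det4 v i j k l := by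
  simp [det4, Matrix.det_succ_row_zero, Fin.sum_univ_succ, Fin.succAbove]
  ring

/-- The three-term Plücker relation. -/
theorem det4_pluecker (a b i j k l : Fin N) :
    det4 v a b i j * det4 v a b k l - det4 v a b i k * det4 v a b j l +
      det4 v a b i l * det4 v a b j k = 0 := by
  simp [det4, Matrix.det_succ_row_zero, Fin.sum_univ_succ, Fin.succAbove]
  ring

variable {v}

theorem GeneralPosition.det4_ne_zero (hv : GeneralPosition v) {i j k l : Fin N}
    (h : [i, j, k, l].Nodup) : det4 v i j k l ≠ 0 := by
  have hs : Function.Injective ![i, j, k, l] := by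
    have := List.nodup_ofFn.mp (show (List.ofFn ![i, j, k, l]).Nodup by simpa using h)
    exact this
  have hl := hv _ hs
  have e : (Matrix.of ![v i, v j, v k, v l]) = Matrix.of (v ∘ ![i, j, k, l]) := by
    ext a b; fin_cases a <;> rfl
  rw [det4, Matrix.det_transpose, e]
  exact ((Matrix.isUnit_iff_isUnit_det _).mp
    ((Matrix.linearIndependent_rows_iff_isUnit).mp hl)).ne_zero

theorem GeneralPosition.comp_perm (hv : GeneralPosition v) (σ : Equiv.Perm (Fin N)) :
    GeneralPosition (v ∘ σ) := fun s hs => hv (σ ∘ s) (σ.injective.comp hs)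

end det4

/-! ### Calculus in exterior squares -/

section Wedge
variable {M : Type u} [AddCommGroup M] [Module Coeff M]

theorem wedgeBilin_apply (a b : M) : wedgeBilin M a b = wedge a b := rfl

theorem wedge_zsmul_left (n : ℤ) (a b : M) : wedge (n • a) b = n • wedge a b := by
  simp only [← wedgeBilin_apply, map_zsmul, LinearMap.smul_apply]

theorem wedge_zsmul_right (n : ℤ) (a b : M) : wedge a (n • b) = n • wedge a b := by
  simp only [← wedgeBilin_apply, map_zsmul]

theorem wedge_neg_left (a b : M) : wedge (-a) b = -wedge a b := by
  simp only [← wedgeBilin_apply, map_neg, LinearMap.neg_apply]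

theorem wedge_neg_right (a b : M) : wedge a (-b) = -wedge a b := by
  simp only [← wedgeBilin_apply, map_neg]

theorem wedge_sub_left (a a' b : M) : wedge (a - a') b = wedge a b - wedge a' b := by
  simp only [← wedgeBilin_apply, map_sub, LinearMap.sub_apply]

theorem wedge_sub_right (a b b' : M) : wedge a (b - b') = wedge a b - wedge a b' := by
  simp only [← wedgeBilin_apply, map_sub]

theorem wedge_comm (a b : M) : wedge a b = -wedge b a := by
  have h := wedge_self (a + b)
  rw [wedge_add_left, wedge_add_right, wedge_add_right, wedge_self, wedge_self, zero_add,
    add_zero] at h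
  exact eq_neg_of_add_eq_zero_left h

theorem wedge_list_sum {ι κ : Type} (f : ι → M) (g : κ → M) (P : List (ℤ × ι))
    (Q : List (ℤ × κ)) :
    wedge (P.map fun p => p.1 • f p.2).sum (Q.map fun q => q.1 • g q.2).sum =
      ((P.flatMap fun p => Q.map fun q => (p.1 * q.1, (p.2, q.2))).map
        fun t => t.1 • wedge (f t.2.1) (g t.2.2)).sum := by
  induction P with
  | nil => simp [wedge_zero_left]
  | cons p P ih =>
    rw [List.map_cons, List.sum_cons, wedge_add_left, ih, List.flatMap_cons, List.map_append,
      List.sum_append]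
    congr 1
    clear ih
    induction Q with
    | nil => simp [wedge_zero_right]
    | cons q Q ih =>
      rw [List.map_cons, List.sum_cons, wedge_add_right, ih]
      simp [wedge_zsmul_left, wedge_zsmul_right, mul_smul, smul_comm q.1]

end Wedge

theorem eq_zero_of_eq_neg {M : Type u} [AddCommGroup M] [Module Coeff M] {x : M} (h : x = -x) :
    x = 0 := by
  refine isUnit_two.smul_eq_zero.mp (?_ : (2 : Coeff) • x = 0)
  rw [two_smul]
  nth_rw 1 [h]
  exact neg_add_cancel x

/-! ### Evaluation of letters and monomials at a configuration -/

variable {F : Type u} [Field F]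

/-- The determinant whose vanishing means that the lines `aa'`, `bb'`, `cc'` are concurrent after
projection from the point `p`. -/
def concurrency {N : ℕ} (v : Fin N → Fin 4 → F) (p a a' b b' c c' : Fin N) : F :=
  det4 v p a a' b' * det4 v p b c c' - det4 v p a a' b * det4 v p b' c c'

/-- Evaluation of a letter at a configuration. -/
noncomputable def Letter.eval (v : Fin 8 → Fin 4 → F) : Letter → MulGrp F
  | .br i j k l => cls (det4 v i j k l)
  | .conc p a a' b b' c c' => cls (concurrency v p a a' b b' c c')

theorem Letter.eval_map (v : Fin 8 → Fin 4 → F) (σ : Fin 8 → Fin 8) (x : Letter) :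
    (x.map σ).eval v = x.eval (v ∘ σ) := by
  cases x <;> rfl

/-- Adjacent transpositions generate all rearrangements: the entry a' is brought to the front, then
the remaining two are compared. No distinctness of the entries is needed. The version for four
entries descends to this one. -/
theorem eq_of_perm₃ {α β : Type*} {f : α → α → α → β} (h₁ : ∀ a b c, f b a c = f a b c)
    (h₂ : ∀ a b c, f a c b = f a b c) {a b c a' b' c' : α} (h : [a, b, c].Perm [a', b', c']) :
    f a b c = f a' b' c' := by
  have two : ∀ {x b c b' c' : α}, [b, c].Perm [b', c'] → f x b c = f x b' c' := by
    intro x b c b' c' h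
    have hb : b' ∈ [b, c] := h.mem_iff.mpr (by simp)
    simp only [List.mem_cons, List.not_mem_nil, or_false] at hb
    rcases hb with rfl | rfl
    · have := (List.perm_cons _).mp h
      rw [List.singleton_perm_singleton.mp this]
    · have := (List.perm_cons _).mp ((List.Perm.swap _ _ _).trans h)
      rw [List.singleton_perm_singleton.mp this, h₂]
  have ha : a' ∈ [a, b, c] := h.mem_iff.mpr (by simp)
  simp only [List.mem_cons, List.not_mem_nil, or_false] at ha
  rcases ha with rfl | rfl | rfl
  · exact two ((List.perm_cons _).mp h)
  · exact (h₁ _ _ _).trans (two ((List.perm_cons _).mp ((List.Perm.swap _ _ _).trans h)))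
  · exact ((h₂ _ _ _).symm.trans (h₁ _ _ _)).trans (two ((List.perm_cons _).mp
      ((List.Perm.swap _ _ _).trans (((List.Perm.swap _ _ _).cons _).trans h))))

theorem eq_of_perm₄ {α β : Type*} {f : α → α → α → α → β}
    (h₁ : ∀ a b c d, f b a c d = f a b c d) (h₂ : ∀ a b c d, f a c b d = f a b c d)
    (h₃ : ∀ a b c d, f a b d c = f a b c d) {a b c d a' b' c' d' : α}
    (h : [a, b, c, d].Perm [a', b', c', d']) : f a b c d = f a' b' c' d' := by
  have three : ∀ {x b c d b' c' d' : α}, [b, c, d].Perm [b', c', d'] →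
      f x b c d = f x b' c' d' := fun {x} _ _ _ _ _ _ h => eq_of_perm₃ (h₂ x) (h₃ x) h
  have ha : a' ∈ [a, b, c, d] := h.mem_iff.mpr (by simp)
  simp only [List.mem_cons, List.not_mem_nil, or_false] at ha
  rcases ha with rfl | rfl | rfl | rfl
  · exact three ((List.perm_cons _).mp h)
  · exact (h₁ _ _ _ _).trans (three ((List.perm_cons _).mp ((List.Perm.swap _ _ _).trans h)))
  · exact ((h₂ _ _ _ _).symm.trans (h₁ _ _ _ _)).trans (three ((List.perm_cons _).mp
      ((List.Perm.swap _ _ _).trans (((List.Perm.swap _ _ _).cons _).trans h))))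
  · exact ((h₃ _ _ _ _).symm.trans ((h₂ _ _ _ _).symm.trans (h₁ _ _ _ _))).trans
      (three ((List.perm_cons _).mp ((List.Perm.swap _ _ _).trans
        (((List.Perm.swap _ _ _).cons _).trans
          ((((List.Perm.swap _ _ _).cons _).cons _).trans h)))))

theorem cls_det4_perm {N : ℕ} (v : Fin N → Fin 4 → F) {i j k l i' j' k' l' : Fin N}
    (h : [i, j, k, l].Perm [i', j', k', l']) : cls (det4 v i j k l) = cls (det4 v i' j' k' l') :=
  eq_of_perm₄ (f := fun i j k l => cls (det4 v i j k l))
    (fun _ _ _ _ => by rw [det4_swap₁₂, cls_neg]) (fun _ _ _ _ => by rw [det4_swap₂₃, cls_neg])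
    (fun _ _ _ _ => by rw [det4_swap₃₄, cls_neg]) h

theorem concurrency_swap₁ {N : ℕ} (v : Fin N → Fin 4 → F) (p a a' b b' c c' : Fin N) :
    concurrency v p a' a b b' c c' = -concurrency v p a a' b b' c c' := by
  rw [concurrency, concurrency, det4_swap₂₃ v p a a' b, det4_swap₂₃ v p a a' b']
  ring

theorem concurrency_swap₂ {N : ℕ} (v : Fin N → Fin 4 → F) (p a a' b b' c c' : Fin N) :
    concurrency v p a a' b' b c c' = -concurrency v p a a' b b' c c' := by
  rw [concurrency, concurrency]
  ring

theorem concurrency_swap₃ {N : ℕ} (v : Fin N → Fin 4 → F) (p a a' b b' c c' : Fin N) :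
    concurrency v p a a' b b' c' c = -concurrency v p a a' b b' c c' := by
  rw [concurrency, concurrency, det4_swap₃₄ v p b' c c', det4_swap₃₄ v p b c c']
  ring

theorem Letter.eval_eq_of_equiv (v : Fin 8 → Fin 4 → F) {x y : Letter} (h : x.equiv y = true) :
    x.eval v = y.eval v := by
  cases x <;> cases y
  · exact cls_det4_perm v (List.isPerm_iff.mp h)
  · simp [Letter.equiv] at h
  · simp [Letter.equiv] at h
  · rename_i p a a' b b' c c' q d d' e e' f f'
    simp only [Letter.equiv, Bool.and_eq_true, Bool.or_eq_true, beq_iff_eq] at h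
    obtain ⟨⟨⟨rfl, h₁⟩, h₂⟩, h₃⟩ := h
    calc cls (concurrency v p a a' b b' c c')
      _ = cls (concurrency v p d d' b b' c c') := by
        rcases h₁ with ⟨rfl, rfl⟩ | ⟨rfl, rfl⟩
        · rfl
        · rw [concurrency_swap₁, cls_neg]
      _ = cls (concurrency v p d d' e e' c c') := by
        rcases h₂ with ⟨rfl, rfl⟩ | ⟨rfl, rfl⟩
        · rfl
        · rw [concurrency_swap₂, cls_neg]
      _ = cls (concurrency v p d d' e e' f f') := by
        rcases h₃ with ⟨rfl, rfl⟩ | ⟨rfl, rfl⟩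
        · rfl
        · rw [concurrency_swap₃, cls_neg]

/-- Evaluation of a pair of letters. -/
noncomputable def pairEval (v : Fin 8 → Fin 4 → F) (x : Letter × Letter) : Ext2 (MulGrp F) :=
  wedge (x.1.eval v) (x.2.eval v)

theorem pairEval_eq (v : Fin 8 → Fin 4 → F) {x y : Letter × Letter} (h : pairSign x y ≠ 0) :
    pairEval v x = pairSign x y • pairEval v y := by
  unfold pairSign at h ⊢
  split_ifs with h₁ h₂
  · rw [Bool.and_eq_true] at h₁
    rw [one_smul, pairEval, pairEval, Letter.eval_eq_of_equiv v h₁.1,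
      Letter.eval_eq_of_equiv v h₁.2]
  · rw [Bool.and_eq_true] at h₂
    rw [neg_one_smul, pairEval, pairEval, Letter.eval_eq_of_equiv v h₂.1,
      Letter.eval_eq_of_equiv v h₂.2, wedge_comm]
  · simp_all

namespace Mono

/-- Evaluation of a monomial. -/
noncomputable def eval (v : Fin 8 → Fin 4 → F) (m : Mono) : Ext2 (Ext2 (MulGrp F)) :=
  wedge (pairEval v m.1) (pairEval v m.2)

theorem eval_map (v : Fin 8 → Fin 4 → F) (σ : Fin 8 → Fin 8) (m : Mono) :
    (m.map σ).eval v = m.eval (v ∘ σ) := by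
  simp only [eval, pairEval, map, Letter.eval_map]

theorem eval_eq (v : Fin 8 → Fin 4 → F) {m n : Mono} (h : relSign m n ≠ 0) :
    m.eval v = relSign m n • n.eval v := by
  unfold relSign at h ⊢
  simp only at h ⊢
  split_ifs at h ⊢ with h₁
  · have h' := neg_ne_zero.mp h
    rw [eval, pairEval_eq v (left_ne_zero_of_mul h'), pairEval_eq v (right_ne_zero_of_mul h'),
      wedge_zsmul_left, wedge_zsmul_right, smul_smul, wedge_comm, smul_neg, neg_smul, eval]
  · rw [eval, pairEval_eq v (left_ne_zero_of_mul h), pairEval_eq v (right_ne_zero_of_mul h),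
      wedge_zsmul_left, wedge_zsmul_right, smul_smul, eval]

/-- The alternation of a monomial. -/
noncomputable def alt (v : Fin 8 → Fin 4 → F) (m : Mono) : Ext2 (Ext2 (MulGrp F)) :=
  Alt (fun w => m.eval w) v

theorem alt_eq (v : Fin 8 → Fin 4 → F) {m n : Mono} (h : relSign m n ≠ 0) :
    m.alt v = relSign m n • n.alt v := by
  rw [alt, alt, ← Alt_zsmul]
  exact Alt_congr fun σ => eval_eq _ h

/-- No word contains a trivial transposition. -/
def Reduced (l : List (Fin 8 × Fin 8)) : Prop := ∀ t ∈ l, t.1 ≠ t.2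

instance (l : List (Fin 8 × Fin 8)) : Decidable (Reduced l) :=
  inferInstanceAs (Decidable (∀ t ∈ l, t.1 ≠ t.2))

/-- Each transposition reindexes the alternation and costs one sign. A trivial transposition would
cost none, whence the condition `Reduced`. -/
theorem alt_act (v : Fin 8 → Fin 4 → F) {l : List (Fin 8 × Fin 8)} (hl : Reduced l) (m : Mono) :
    (m.act l).alt v = (-1 : ℤ) ^ l.length • m.alt v := by
  induction l with
  | nil => simp [act]
  | cons t l ih =>
    have h := Alt_comp_perm (fun w => (m.act l).eval w) v (Equiv.swap t.1 t.2)
    rw [Equiv.Perm.sign_swap (hl t (by simp))] at h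
    have e : (m.act (t :: l)).alt v = Alt (fun w => (m.act l).eval (w ∘ Equiv.swap t.1 t.2)) v :=
      Alt_congr fun σ => eval_map _ _ _
    have ih' := ih fun s hs => hl s (by simp [hs])
    rw [alt] at ih'
    rw [e, h, ih', List.length_cons, pow_succ', mul_smul]
    rfl

theorem reduced_oddWords : ∀ l ∈ oddWords, Reduced l := by decide

theorem reduced_stripWords : ∀ l ∈ stripWords, Reduced l := by decide

/-- Soundness of the combinatorial test. In the first case the sign from relabelling by a word and
the sign read off from the relabelled letters disagree, so the alternation is its own negative. In
the second case both signs together give the multiple of the strip. -/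
theorem alt_eq_stripCoeff (v : Fin 8 → Fin 4 → F) {m : Mono} {n : ℤ} (h : m.stripCoeff = some n) :
    m.alt v = n • strip.alt v := by
  unfold stripCoeff at h
  split_ifs at h with h₀
  · obtain ⟨l, hl, hs⟩ := List.any_eq_true.mp h₀
    rw [beq_iff_eq] at hs
    cases h
    have hs' : relSign (m.act l) m ≠ 0 := by
      rw [hs]; exact neg_ne_zero.mpr (pow_ne_zero _ (by norm_num))
    have e := (alt_act v (reduced_oddWords l hl) m).symm.trans (alt_eq v hs')
    rw [hs] at e
    rw [zero_smul]
    rcases neg_one_pow_eq_or ℤ l.length with h | h <;> rw [h] at e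
    · exact eq_zero_of_eq_neg (by simpa using e)
    · exact eq_zero_of_eq_neg (by simpa using e.symm)
  · obtain ⟨l, hl, rfl⟩ := Option.map_eq_some_iff.mp h
    have hs := List.find?_some hl
    have hs' : relSign m (strip.act l) ≠ 0 := by simpa using hs
    rw [alt_eq v hs', alt_act v (reduced_stripWords l (List.mem_of_find?_eq_some hl)), smul_smul]

end Mono

theorem Alt_list_sum (v : Fin 8 → Fin 4 → F) {L : List (ℤ × Mono)} {n : ℤ}
    (h : totalCoeff L = some n) :
    Alt (fun w => (L.map fun t => t.1 • t.2.eval w).sum) v = n • Mono.strip.alt v := by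
  induction L generalizing n with
  | nil =>
    cases h
    simp [Alt_zero]
  | cons t L ih =>
    obtain ⟨k, hk, h⟩ := Option.bind_eq_some_iff.mp (show (t.2.stripCoeff.bind fun n =>
      (totalCoeff L).map fun k => t.1 * n + k) = some n from h)
    obtain ⟨j, hj, rfl⟩ := Option.map_eq_some_iff.mp h
    simp only [List.map_cons, List.sum_cons]
    rw [Alt_add, ih hj, Alt_zsmul, add_smul, mul_smul, ← Mono.alt_eq_stripCoeff v hk]
    rfl

/-! ### From formal expansions to symbols of cross-ratios and triple ratios -/

/-- Evaluation of a formal linear combination of letters. -/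
noncomputable def Form.eval (v : Fin 8 → Fin 4 → F) (A : Form) : MulGrp F :=
  (A.map fun t => t.1 • t.2.eval v).sum

/-- Evaluation of a formal linear combination of pairs of letters. -/
noncomputable def pairsEval (v : Fin 8 → Fin 4 → F) (P : List (ℤ × (Letter × Letter))) :
    Ext2 (MulGrp F) :=
  (P.map fun t => t.1 • pairEval v t.2).sum

theorem Form.eval_append (v : Fin 8 → Fin 4 → F) (A B : Form) :
    Form.eval v (A ++ B) = A.eval v + B.eval v := by
  simp [Form.eval]

theorem Form.eval_neg (v : Fin 8 → Fin 4 → F) (A : Form) : A.neg.eval v = -A.eval v := by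
  induction A with
  | nil => simp [Form.eval, Form.neg]
  | cons t A ih =>
    simp only [Form.eval, Form.neg, List.map_cons, List.sum_cons] at ih ⊢
    rw [ih, neg_smul, neg_add]

theorem Form.wedge_eval (v : Fin 8 → Fin 4 → F) (A B : Form) :
    pairsEval v (Form.wedge A B) = Weight4.wedge (A.eval v) (B.eval v) :=
  (wedge_list_sum _ _ A B).symm

theorem expand_eval (v : Fin 8 → Fin 4 → F) (P Q : List (ℤ × (Letter × Letter))) :
    ((expand P Q).map fun t => t.1 • t.2.eval v).sum = wedge (pairsEval v P) (pairsEval v Q) :=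
  (wedge_list_sum _ _ P Q).symm

/-- The formal list omits the term D ∧ D, which is zero; this keeps the later enumeration of
monomials smaller. -/
theorem Form.bloch_eval (v : Fin 8 → Fin 4 → F) (A N D : Form) :
    pairsEval v (Form.bloch A N D) =
      Weight4.wedge (A.eval v - D.eval v) (N.eval v - D.eval v) := by
  have e : pairsEval v (Form.bloch A N D) = pairsEval v (Form.wedge (A ++ D.neg) N) +
      pairsEval v (Form.wedge A D.neg) := by simp [pairsEval, Form.bloch]
  rw [e, Form.wedge_eval, Form.wedge_eval, Form.eval_append, Form.eval_neg, wedge_sub_right,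
    wedge_sub_left _ _ (D.eval v), wedge_self, sub_zero, wedge_neg_right, ← sub_eq_add_neg,
    ← sub_eq_add_neg]

theorem cls_inv {x : F} (hx : x ≠ 0) : cls x⁻¹ = -cls x := by
  have h := cls_mul hx (inv_ne_zero hx)
  rw [mul_inv_cancel₀ hx, cls_one] at h
  exact eq_neg_of_add_eq_zero_right h.symm

theorem cls_div {x y : F} (hx : x ≠ 0) (hy : y ≠ 0) : cls (x / y) = cls x - cls y := by
  rw [div_eq_mul_inv, cls_mul hx (inv_ne_zero hy), cls_inv hy, sub_eq_add_neg]

/-- The symbol `(1 - r) ∧ r` in terms of numerators and denominators. -/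
theorem wedge_one_sub_div {n m a b : F} (hn : n ≠ 0) (hm : m ≠ 0) (ha : a ≠ 0)
    (h : m - n = a * b) :
    wedge (cls (1 - n / m)) (cls (n / m)) =
      wedge (cls a + cls b - cls m) (cls n - cls m) := by
  rcases eq_or_ne b 0 with rfl | hb
  -- The factor b will be the concurrency determinant, which may vanish even in general position.
  -- Then the ratio is 1 and both sides are zero, whatever class is assigned to b.
  · rw [mul_zero, sub_eq_zero] at h
    rw [h, div_self hn, cls_one, wedge_zero_right, sub_self, wedge_zero_right]
  · have e : 1 - n / m = a * b / m := by rw [← h, sub_div, div_self hm]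
    rw [e, cls_div (mul_ne_zero ha hb) hm, cls_mul ha hb, cls_div hn hm]

section symbols
variable {v : Fin 8 → Fin 4 → F}

theorem Form.eval_two (x y : Letter) :
    Form.eval v [(1, x), (1, y)] = x.eval v + y.eval v := by simp [Form.eval]

theorem Form.eval_three (x y z : Letter) :
    Form.eval v [(1, x), (1, y), (1, z)] = x.eval v + (y.eval v + z.eval v) := by
  simp [Form.eval]

theorem crossRatio_symbol (hv : GeneralPosition v) {a b i j k l : Fin 8}
    (h : [a, b, i, j, k, l].Nodup) :
    wedge (cls (1 - crossRatio v a b i j k l)) (cls (crossRatio v a b i j k l)) =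
      pairsEval v (Form.bloch (crOne a b i j k l) (crNum a b i j k l) (crDen a b i j k l)) := by
  have n₁ : det4 v a b i k ≠ 0 := hv.det4_ne_zero (by simp at h ⊢; tauto)
  have n₂ : det4 v a b j l ≠ 0 := hv.det4_ne_zero (by simp at h ⊢; tauto)
  have n₃ : det4 v a b i l ≠ 0 := hv.det4_ne_zero (by simp at h ⊢; tauto)
  have n₄ : det4 v a b j k ≠ 0 := hv.det4_ne_zero (by simp at h ⊢; tauto)
  have n₅ : det4 v a b i j ≠ 0 := hv.det4_ne_zero (by simp at h ⊢; tauto)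
  rw [crossRatio, wedge_one_sub_div (a := det4 v a b i j) (b := -det4 v a b k l)
    (mul_ne_zero n₁ n₂) (mul_ne_zero n₃ n₄) n₅
    (by linear_combination det4_pluecker v a b i j k l),
    Form.bloch_eval, crOne, crNum, crDen, cls_neg, cls_mul n₁ n₂, cls_mul n₃ n₄]
  simp only [Form.eval_two, Letter.eval]

/-- After projection from a, a triple ratio equals 1 exactly when b, c, d are collinear or the lines
be, cf, dg are concurrent. The factorization combines two Plücker relations, with common pairs (a,
d) and (a, b). -/
theorem tripleRatio_one_sub {N : ℕ} (v : Fin N → Fin 4 → F) (a b c d e f g : Fin N) :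
    det4 v a b c f * det4 v a c d g * det4 v a d b e -
      det4 v a b c e * det4 v a c d f * det4 v a d b g =
    det4 v a b c d * concurrency v a b e c f d g := by
  have h₁ := det4_pluecker v a d b c f g
  have h₂ := det4_pluecker v a b c d e f
  rw [det4_swap₂₃ v a b d c, det4_swap₃₄ v a b c d, det4_swap₂₃ v a b d f,
    det4_swap₂₃ v a c d g, det4_swap₂₃ v a c d f] at h₁
  rw [concurrency, det4_swap₂₃ v a b d e, det4_swap₃₄ v a b c e, det4_swap₂₃ v a d f g]
  linear_combination det4 v a b c e * h₁ - det4 v a c d g * h₂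

theorem tripleRatio_symbol (hv : GeneralPosition v) {a b c d e f g : Fin 8}
    (h : [a, b, c, d, e, f, g].Nodup) :
    wedge (cls (1 - tripleRatio v a b c d e f g)) (cls (tripleRatio v a b c d e f g)) =
        pairsEval v (Form.bloch (trOne a b c d e f g) (trNum a b c d e f g)
          (trDen a b c d e f g)) ∧
      cls (tripleRatio v a b c d e f g) =
        Form.eval v (trNum a b c d e f g ++ (trDen a b c d e f g).neg) := by
  have n₁ : det4 v a b c e ≠ 0 := hv.det4_ne_zero (by simp at h ⊢; tauto)
  have n₂ : det4 v a c d f ≠ 0 := hv.det4_ne_zero (by simp at h ⊢; tauto)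
  have n₃ : det4 v a d b g ≠ 0 := hv.det4_ne_zero (by simp at h ⊢; tauto)
  have n₄ : det4 v a b c f ≠ 0 := hv.det4_ne_zero (by simp at h ⊢; tauto)
  have n₅ : det4 v a c d g ≠ 0 := hv.det4_ne_zero (by simp at h ⊢; tauto)
  have n₆ : det4 v a d b e ≠ 0 := hv.det4_ne_zero (by simp at h ⊢; tauto)
  have n₇ : det4 v a b c d ≠ 0 := hv.det4_ne_zero (by simp at h ⊢; tauto)
  constructor
  · rw [tripleRatio, wedge_one_sub_div (mul_ne_zero (mul_ne_zero n₁ n₂) n₃)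
      (mul_ne_zero (mul_ne_zero n₄ n₅) n₆) n₇ (tripleRatio_one_sub v a b c d e f g),
      Form.bloch_eval, trOne, trNum, trDen, cls_mul (mul_ne_zero n₁ n₂) n₃, cls_mul n₁ n₂,
      cls_mul (mul_ne_zero n₄ n₅) n₆, cls_mul n₄ n₅]
    simp only [Form.eval_two, Form.eval_three, Letter.eval, add_assoc]
  · rw [tripleRatio, cls_div (mul_ne_zero (mul_ne_zero n₁ n₂) n₃)
      (mul_ne_zero (mul_ne_zero n₄ n₅) n₆), Form.eval_append, Form.eval_neg, trNum, trDen,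
      cls_mul (mul_ne_zero n₁ n₂) n₃, cls_mul n₁ n₂,
      cls_mul (mul_ne_zero n₄ n₅) n₆, cls_mul n₄ n₅]
    simp only [Form.eval_three, Letter.eval, add_assoc, sub_eq_add_neg]

theorem cobracket_symbol_tmul (x y : F) :
    cobracket F (S F (gen3 x ⊗ₜ[Coeff] cls y, 0)) =
      wedge (wedge (cls (1 - x)) (cls x)) (wedge (cls x) (cls y)) := by
  simp [cobracket, S, symbol3_gen3, wedgeBilin_apply]

theorem cobracket_symbol_wedge (x y : F) :
    cobracket F (S F (0, wedge (gen2 x) (gen2 y))) =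
      wedge (wedge (cls (1 - x)) (cls x)) (wedge (cls (1 - y)) (cls y)) := by
  simp [cobracket, S, map_wedge, symbol2_gen2]

theorem cobracket_symbol_dualCombination (hv : GeneralPosition v) :
    cobracket F (S F (dualCombination v)) = 0 := by
  have e : cobracket F (S F (dualCombination v)) =
      Alt (fun w : Fin 8 → Fin 4 → F => (28 : ℤ) • (tripleTerms.map fun t => t.1 • t.2.eval w).sum +
        (-6 : ℤ) • (crossTerms.map fun t => t.1 • t.2.eval w).sum) v := by
    refine (map_Alt ((cobracket F).comp (S F)).toAddMonoidHom _ v).trans (Alt_congr fun σ => ?_)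
    have hw := hv.comp_perm σ
    generalize v ∘ σ = w at hw
    have s : ∀ x y : F, ∀ z : Ext2 (B2 F),
        (((28 : Coeff) • (gen3 x ⊗ₜ[Coeff] cls y), -((6 : Coeff) • z)) : Target F) =
          (28 : ℤ) • (gen3 x ⊗ₜ[Coeff] cls y, 0) + (-6 : ℤ) • (0, z) := by
      intro x y z
      refine Prod.ext ?_ ?_
      · simp [← Int.cast_smul_eq_zsmul Coeff]
      · simp [← Int.cast_smul_eq_zsmul Coeff]
    change cobracket F (S F _) = _
    rw [s, map_add, map_add, map_zsmul, map_zsmul, map_zsmul, map_zsmul, cobracket_symbol_tmul,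
      cobracket_symbol_wedge, tripleTerms, crossTerms, expand_eval, expand_eval,
      crossRatio_symbol hw (by decide), crossRatio_symbol hw (by decide),
      (tripleRatio_symbol hw (by decide)).1, Form.wedge_eval,
      (tripleRatio_symbol hw (by decide)).2]
    simp [Form.eval, Letter.eval]
  -- Both sums are multiples of the same alternation, with total coefficient 28 · 6 - 6 · 28.
  rw [e, Alt_add, Alt_zsmul, Alt_zsmul, Alt_list_sum v totalCoeff_tripleTerms,
    Alt_list_sum v totalCoeff_crossTerms, smul_smul, smul_smul, ← add_smul]
  norm_num

end symbols

/-! ### Relations in `B₂` -/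

/-- The projection to `B₂`. -/
noncomputable def toB2 (F : Type u) [Field F] : (F →₀ Coeff) →ₗ[Coeff] B2 F := (R2 F).mkQ

theorem gen2_zero : gen2 (0 : F) = 0 :=
  (Submodule.Quotient.mk_eq_zero _).mpr (Submodule.subset_span (Or.inl rfl))

theorem toB2_specialize_eq {α : RatFunc F →₀ Coeff} (h : formal2 (RatFunc F) α = 0) :
    toB2 F (specialize 0 α) = toB2 F (specialize 1 α) :=
  (Submodule.Quotient.eq _).mpr (Submodule.subset_span (Or.inr ⟨α, LinearMap.mem_ker.mpr h, rfl⟩))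

theorem toB2_specialize_of_ne (a : F) {f : RatFunc F} (h : f.denom.eval a ≠ 0) :
    toB2 F (specialize a (Finsupp.single f 1)) = gen2 (f.eval (RingHom.id F) a) := by
  rw [specialize_single, if_neg h]
  rfl

theorem toB2_specialize_algebraMap (a : F) (p : Polynomial F) :
    toB2 F (specialize a (Finsupp.single (algebraMap _ (RatFunc F) p) 1)) =
      gen2 (p.eval a) := by
  rw [toB2_specialize_of_ne a (by simp), RatFunc.eval_algebraMap]
  simp [Polynomial.eval₂_id]

theorem toB2_specialize_inv (a : F) {p : Polynomial F} (hp : p.eval a ≠ 0) :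
    toB2 F (specialize a (Finsupp.single (algebraMap _ (RatFunc F) p)⁻¹ 1)) =
      gen2 (p.eval a)⁻¹ := by
  have hp0 : p ≠ 0 := by rintro rfl; simp at hp
  have hm : algebraMap _ (RatFunc F) p ≠ 0 := RatFunc.algebraMap_ne_zero hp0
  have hd : ((algebraMap _ (RatFunc F) p)⁻¹).denom.eval a ≠ 0 := by
    obtain ⟨q, hq⟩ := RatFunc.denom_inv_dvd hm
    rw [RatFunc.num_algebraMap] at hq
    intro h
    rw [hq, Polynomial.eval_mul, h, zero_mul] at hp
    exact hp rfl
  have e := RatFunc.eval_mul (RingHom.id F) a (x := algebraMap _ (RatFunc F) p)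
    (y := (algebraMap _ (RatFunc F) p)⁻¹) (by simp) (by simpa [Polynomial.eval₂_id] using hd)
  rw [mul_inv_cancel₀ hm, RatFunc.eval_one, RatFunc.eval_algebraMap] at e
  rw [toB2_specialize_of_ne a hd]
  congr 1
  refine eq_inv_of_mul_eq_one_right ?_
  simpa [Polynomial.eval₂_id] using e.symm

theorem formal2_single_add_one_sub (f : F) :
    formal2 F (Finsupp.single f 1 + Finsupp.single (1 - f) 1) = 0 := by
  rw [map_add, formal2_single, formal2_single, sub_sub_cancel, wedge_comm, neg_add_cancel]

theorem formal2_single_add_inv {f : F} (hf : f ≠ 0) :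
    formal2 F (Finsupp.single f 1 + Finsupp.single f⁻¹ 1) = 0 := by
  rw [map_add, formal2_single, formal2_single, cls_inv hf]
  rcases eq_or_ne (1 - f) 0 with h | h
  · rw [← sub_eq_zero.mp h]
    simp [cls_one, wedge_zero_right]
  · have e : 1 - f⁻¹ = -(1 - f) / f := by field_simp; ring
    rw [e, cls_div (neg_ne_zero.mpr h) hf, cls_neg, wedge_neg_right, wedge_sub_left, wedge_self,
      sub_zero, add_neg_cancel]

/-- {f}₂ + {1/f}₂ has zero symbol over F(t), so its value does not change along the line from x to
1; neither endpoint is a zero of f. -/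
theorem gen2_add_inv_eq {x : F} (hx : x ≠ 0) : gen2 x + gen2 x⁻¹ = gen2 1 + gen2 (1 : F) := by
  obtain ⟨p, h0, h1⟩ : ∃ p : Polynomial F, p.eval 0 = x ∧ p.eval 1 = 1 :=
    ⟨.C x + .C (1 - x) * .X, by simp, by simp⟩
  have hp : p ≠ 0 := by rintro h; simp [h] at h1
  have h := toB2_specialize_eq (formal2_single_add_inv (RatFunc.algebraMap_ne_zero hp))
  rw [map_add, map_add, map_add, map_add, toB2_specialize_algebraMap, toB2_specialize_algebraMap,
    toB2_specialize_inv 0 (by rwa [h0]), toB2_specialize_inv 1 (by rw [h1]; exact one_ne_zero),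
    h0, h1, inv_one] at h
  exact h

/-- The same relation for f = t. At t = 0 both terms disappear, one as {0}₂ and the other as a pole;
at t = 1 the value is 2{1}₂, and 2 is invertible. -/
theorem gen2_one : gen2 (1 : F) = 0 := by
  have hX : (RatFunc.X : RatFunc F) ≠ 0 := RatFunc.X_ne_zero
  have h := toB2_specialize_eq (formal2_single_add_inv hX)
  have hd : ((RatFunc.X : RatFunc F)⁻¹).denom.eval 0 = 0 := by
    obtain ⟨q, hq⟩ := (RatFunc.associated_denom_inv hX).symm.dvd
    rw [hq, RatFunc.num_X, Polynomial.eval_mul, Polynomial.eval_X, zero_mul]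
  have hz : toB2 F (specialize 0 (Finsupp.single (RatFunc.X : RatFunc F)⁻¹ 1)) = 0 := by
    rw [specialize_single, if_pos hd, map_zero]
  rw [map_add, map_add, map_add, map_add, hz, ← RatFunc.algebraMap_X, toB2_specialize_algebraMap,
    toB2_specialize_algebraMap, toB2_specialize_inv 1 (by simp), Polynomial.eval_X,
    Polynomial.eval_X, inv_one, gen2_zero, zero_add] at h
  exact eq_zero_of_eq_neg (eq_neg_of_add_eq_zero_left h.symm)

theorem gen2_inv (x : F) : gen2 x⁻¹ = -gen2 x := by
  rcases eq_or_ne x 0 with rfl | hx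
  · rw [inv_zero, gen2_zero, neg_zero]
  · have h := gen2_add_inv_eq hx
    rw [gen2_one, add_zero] at h
    exact eq_neg_of_add_eq_zero_right h

theorem gen2_one_sub (x : F) : gen2 (1 - x) = -gen2 x := by
  obtain ⟨p, h0, h1⟩ : ∃ p : Polynomial F, p.eval 0 = x ∧ p.eval 1 = 0 :=
    -- A path from x to 0, where {f}₂ + {1 - f}₂ specializes to {0}₂ + {1}₂ = 0.
    ⟨.C x * (1 - .X), by simp, by simp⟩
  have h := toB2_specialize_eq (formal2_single_add_one_sub (algebraMap _ (RatFunc F) p))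
  have e : 1 - algebraMap _ (RatFunc F) p = algebraMap _ (RatFunc F) (1 - p) := by simp
  rw [e, map_add, map_add, map_add, map_add, toB2_specialize_algebraMap, toB2_specialize_algebraMap,
    toB2_specialize_algebraMap, toB2_specialize_algebraMap] at h
  rw [Polynomial.eval_sub, Polynomial.eval_sub, Polynomial.eval_one, Polynomial.eval_one, h0, h1,
    sub_zero, gen2_zero, gen2_one, add_zero] at h
  exact eq_neg_of_add_eq_zero_right h

/-! ### Symmetries of the cross-ratio -/

theorem crossRatio_inv {N : ℕ} (v : Fin N → Fin 4 → F) (a b i j k l : Fin N) :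
    crossRatio v a b k l j i = (crossRatio v a b i j k l)⁻¹ := by
  rw [crossRatio, crossRatio, det4_swap₃₄ v a b j k, det4_swap₃₄ v a b i l,
    det4_swap₃₄ v a b i k, det4_swap₃₄ v a b j l, neg_mul_neg, neg_mul_neg, inv_div]
  ring

theorem gen2_crossRatio_inv {N : ℕ} (v : Fin N → Fin 4 → F) (a b i j k l : Fin N) :
    gen2 (crossRatio v a b k l j i) = -gen2 (crossRatio v a b i j k l) := by
  rw [crossRatio_inv, gen2_inv]

/-- Rotating the last four points sends r to (1 - 1/r)⁻¹: two inversions and one reflection x ↦ 1 -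
x, each changing the sign in B₂. -/
theorem gen2_crossRatio_rotate {N : ℕ} {v : Fin N → Fin 4 → F} (hv : GeneralPosition v)
    {a b i j k l : Fin N} (h : [a, b, i, j, k, l].Nodup) :
    gen2 (crossRatio v a b j k l i) = -gen2 (crossRatio v a b i j k l) := by
  have n₁ : det4 v a b i k ≠ 0 := hv.det4_ne_zero (by simp at h ⊢; tauto)
  have n₂ : det4 v a b j l ≠ 0 := hv.det4_ne_zero (by simp at h ⊢; tauto)
  have e : crossRatio v a b j k l i = (1 - (crossRatio v a b i j k l)⁻¹)⁻¹ := by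
    rw [crossRatio, crossRatio, inv_div, det4_swap₃₄ v a b i k, det4_swap₃₄ v a b i j,
      one_sub_div (mul_ne_zero n₁ n₂), inv_div]
    have hp : det4 v a b i k * det4 v a b j l - det4 v a b i l * det4 v a b j k =
        det4 v a b i j * det4 v a b k l := by
      linear_combination -det4_pluecker v a b i j k l
    rw [hp, mul_neg, neg_mul, neg_div_neg_eq, mul_comm (det4 v a b j l)]
  rw [e, gen2_inv, gen2_one_sub, gen2_inv, neg_neg]

/-! ### The differential as an alternation -/

/-- The permutations of N + 1 points are sorted by the point placed first, which the expression
ignores; permuting the others is the alternation of the corresponding face. -/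
theorem Alt_comp_succ {M : Type u} [AddCommGroup M] {N : ℕ} (g : (Fin N → Fin 4 → F) → M)
    (v : Fin (N + 1) → Fin 4 → F) :
    Alt (fun w => g (w ∘ Fin.succ)) v =
      ∑ i : Fin (N + 1), (-1 : ℤ) ^ (i : ℕ) • Alt g (v ∘ i.succAbove) := by
  rw [Alt, ← Equiv.Perm.decomposeFin.symm.sum_comp, Fintype.sum_prod_type]
  refine Finset.sum_congr rfl fun i _ => ?_
  rw [Alt, Finset.smul_sum]
  refine Fin.cases ?_ (fun i => ?_) i
  · refine Finset.sum_congr rfl fun e _ => ?_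
    have : (v ∘ Equiv.Perm.decomposeFin.symm (0, e)) ∘ Fin.succ =
        (v ∘ (0 : Fin (N + 1)).succAbove) ∘ e := by
      ext j : 1
      simp
    rw [this, Equiv.Perm.decomposeFin.symm_sign]
    simp
  -- Exchanging 0 with i + 1 leaves the remaining points out of their natural order. The cycle
  -- restores it with sign (-1)^i, and the exchange itself supplies the missing sign in (-1)^(i+1).
  · refine Fintype.sum_equiv (Equiv.mulLeft i.cycleRange) _ _ fun e => ?_
    have : (v ∘ Equiv.Perm.decomposeFin.symm (i.succ, e)) ∘ Fin.succ =
        (v ∘ i.succ.succAbove) ∘ (Equiv.mulLeft i.cycleRange e) := by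
      ext j : 1
      simp [Fin.succAbove_cycleRange]
    rw [this, Equiv.Perm.decomposeFin.symm_sign, Equiv.coe_mulLeft, Equiv.Perm.sign_mul,
      Fin.sign_cycleRange, smul_smul, if_neg (Fin.succ_ne_zero i)]
    congr 1
    rcases neg_one_pow_eq_or ℤ (i : ℕ) with h | h <;> simp [pow_succ, h]

/-! ### Dual configurations -/

/-- The product of a list of transpositions. -/
def wordPerm (l : List (Fin 8 × Fin 8)) : Equiv.Perm (Fin 8) :=
  l.foldr (fun t σ => Equiv.swap t.1 t.2 * σ) 1

theorem sign_wordPerm {l : List (Fin 8 × Fin 8)} (hl : Mono.Reduced l) :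
    (Equiv.Perm.sign (wordPerm l) : ℤ) = (-1) ^ l.length := by
  induction l with
  | nil => simp [wordPerm]
  | cons t l ih =>
    have e : wordPerm (t :: l) = Equiv.swap t.1 t.2 * wordPerm l := rfl
    rw [e, Equiv.Perm.sign_mul, Equiv.Perm.sign_swap (hl t (by simp)), Units.val_mul,
      ih fun s hs => hl s (by simp [hs]), List.length_cons, pow_succ']
    rfl

/-- The word l certifies the ordering of the eight points and at the same time its sign, as the
parity of its length. -/
theorem IsDual.det4_comp {v w : Fin 8 → Fin 4 → F} (h : IsDual v w) (σ : Equiv.Perm (Fin 8))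
    (l : List (Fin 8 × Fin 8)) (hl : Mono.Reduced l) {a b c d e f g k : Fin 8}
    (hv : List.ofFn (wordPerm l) = [a, b, c, d, e, f, g, k]) :
    det4 (w ∘ σ) a b c d =
      ((Equiv.Perm.sign σ : ℤ) : F) * (-1) ^ l.length * det4 (v ∘ σ) e f g k := by
  have h' := h (σ * wordPerm l)
  simp only [List.ofFn_succ, List.ofFn_zero, List.cons.injEq] at hv
  obtain ⟨rfl, rfl, rfl, rfl, rfl, rfl, rfl, rfl, -⟩ := hv
  rw [Equiv.Perm.sign_mul, Units.val_mul, sign_wordPerm hl] at h'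
  push_cast at h'
  exact h'

/-- Complements of brackets through 0 within 0, …, 6 pass through the unused point 7, so the centre
of projection and the unused point trade roles. The signs of σ and of the words cancel between
numerator and denominator. -/
theorem IsDual.tripleRatio_comp {v w : Fin 8 → Fin 4 → F} (h : IsDual v w)
    (σ : Equiv.Perm (Fin 8)) :
    tripleRatio (w ∘ σ) 0 1 2 3 4 5 6 = tripleRatio (v ∘ σ) 7 6 5 4 3 2 1 := by
  rw [tripleRatio, tripleRatio,
    h.det4_comp σ [(3, 4), (4, 7), (5, 6)]
      (by decide) (show _ = [0, 1, 2, 4, 7, 6, 5, 3] by decide +kernel),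
    h.det4_comp σ [(1, 2), (2, 3), (3, 5), (4, 7), (5, 7)]
      (by decide) (show _ = [0, 2, 3, 5, 7, 4, 6, 1] by decide +kernel),
    h.det4_comp σ [(1, 3), (2, 3), (3, 6), (4, 7), (6, 7)]
      (by decide) (show _ = [0, 3, 1, 6, 7, 5, 4, 2] by decide +kernel),
    h.det4_comp σ [(3, 5), (4, 7), (5, 7)]
      (by decide) (show _ = [0, 1, 2, 5, 7, 4, 6, 3] by decide +kernel),
    h.det4_comp σ [(1, 2), (2, 3), (3, 6), (4, 7), (6, 7)]
      (by decide) (show _ = [0, 2, 3, 6, 7, 5, 4, 1] by decide +kernel),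
    h.det4_comp σ [(1, 3), (2, 3), (3, 4), (4, 7), (5, 6)]
      (by decide) (show _ = [0, 3, 1, 4, 7, 6, 5, 2] by decide +kernel)]
  rcases Int.units_eq_one_or (Equiv.Perm.sign σ) with hσ | hσ <;> rw [hσ] <;> norm_num <;> ring

/-- Complementation replaces the centre 0 1 by 6 7 and exchanges the two factors within the
numerator and within the denominator, so the cross-ratio of 2, 3, 4, 5 keeps its value. -/
theorem IsDual.crossRatio_comp {v w : Fin 8 → Fin 4 → F} (h : IsDual v w)
    (σ : Equiv.Perm (Fin 8)) :
    crossRatio (w ∘ σ) 0 1 2 3 4 5 = crossRatio (v ∘ σ) 6 7 2 3 4 5 := by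
  rw [crossRatio, crossRatio,
    h.det4_comp σ [(3, 4), (4, 6), (5, 7)]
      (by decide) (show _ = [0, 1, 2, 4, 6, 7, 3, 5] by decide +kernel),
    h.det4_comp σ [(2, 3), (3, 5), (4, 6), (5, 7), (6, 7)]
      (by decide) (show _ = [0, 1, 3, 5, 6, 7, 2, 4] by decide +kernel),
    h.det4_comp σ [(3, 5), (4, 6), (5, 7), (6, 7)]
      (by decide) (show _ = [0, 1, 2, 5, 6, 7, 3, 4] by decide +kernel),
    h.det4_comp σ [(2, 3), (3, 4), (4, 6), (5, 7)]
      (by decide) (show _ = [0, 1, 3, 4, 6, 7, 2, 5] by decide +kernel)]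
  rcases Int.units_eq_one_or (Equiv.Perm.sign σ) with hσ | hσ <;> rw [hσ] <;> norm_num <;> ring

theorem IsDual.cls_det4_comp {v w : Fin 8 → Fin 4 → F} (h : IsDual v w)
    (σ : Equiv.Perm (Fin 8)) :
    cls (det4 (w ∘ σ) 0 1 4 7) = cls (det4 (v ∘ σ) 6 5 3 2) := by
  rw [h.det4_comp σ [(2, 4), (3, 7), (4, 6), (6, 7)]
      (by decide) (show _ = [0, 1, 4, 7, 6, 5, 3, 2] by decide +kernel)]
  rcases Int.units_eq_one_or (Equiv.Perm.sign σ) with hσ | hσ <;> rw [hσ] <;>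
    norm_num [cls_neg]

/-! ### Comparison of the dual combination with f₇(4) ∘ d -/

theorem f7_d_single (v : Conf F 8) :
    f7 F (d F 7 (Finsupp.single v 1)) =
      Alt (fun w : Fin 8 → Fin 4 → F =>
        ((2 : Coeff) • (gen3 (tripleRatio w 1 2 3 4 5 6 7) ⊗ₜ[Coeff] cls (det4 w 2 3 5 6)),
          threeSevenths • wedge (gen2 (crossRatio w 1 2 3 4 5 6))
            (gen2 (crossRatio w 3 4 1 2 5 7)))) v.1 := by
  let g : (Fin 7 → Fin 4 → F) → Target F := fun w =>
    ((2 : Coeff) • (gen3 (tripleRatio w 0 1 2 3 4 5 6) ⊗ₜ[Coeff] cls (det4 w 1 2 4 5)),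
      threeSevenths • wedge (gen2 (crossRatio w 0 1 2 3 4 5)) (gen2 (crossRatio w 2 3 0 1 4 6)))
  have hg : ∀ w : Conf F 7, f7 F (Finsupp.single w 1) = Alt g w.1 := by
    intro w
    refine ((Finsupp.linearCombination_single Coeff (1 : Coeff) w).trans (one_smul _ _)).trans ?_
    rw [f31, f22, ← Alt_smul, ← Alt_smul]
    exact (Alt_prodMk _ _ w.1).symm
  refine Eq.trans ?_ (Alt_comp_succ g v.1).symm
  have hd : d F 7 (Finsupp.single v 1) =
      ∑ i : Fin 8, (-1 : Coeff) ^ (i : ℕ) • Finsupp.single (v.face i) (1 : Coeff) :=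
    (Finsupp.linearCombination_single Coeff (1 : Coeff) v).trans (one_smul _ _)
  rw [hd, map_sum]
  refine Finset.sum_congr rfl fun i _ => ?_
  rw [map_smul, hg, ← Int.cast_smul_eq_zsmul Coeff]
  push_cast
  rfl

theorem seven_mul_threeSevenths : (7 : Coeff) * threeSevenths = 3 := by
  rw [threeSevenths, mul_left_comm, IsUnit.mul_val_inv, mul_one]

theorem IsDual.dualCombination_eq {v w : Conf F 8} (h : IsDual v.1 w.1) :
    dualCombination w.1 = (-14 : Coeff) • f7 F (d F 7 (Finsupp.single v 1)) := by
  let g₁ : (Fin 8 → Fin 4 → F) → Target F := fun x =>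
    (gen3 (tripleRatio x 1 2 3 4 5 6 7) ⊗ₜ[Coeff] cls (det4 x 2 3 5 6), 0)
  let g₂ : (Fin 8 → Fin 4 → F) → Target F := fun x =>
    (0, wedge (gen2 (crossRatio x 1 2 3 4 5 6)) (gen2 (crossRatio x 3 4 1 2 5 7)))
  have reidx : ∀ (y : Fin 8 → Fin 4 → F) (σ : Equiv.Perm (Fin 8)) {l : List (Fin 8 × Fin 8)}
      {p : Fin 8 → Fin 8}, ⇑(wordPerm l) = p → y ∘ ⇑(σ * wordPerm l) = (y ∘ σ) ∘ p :=
    fun y σ _ _ h => by rw [Equiv.Perm.coe_mul, h]; rfl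
  obtain ⟨τ₁, hτ₁, h₁⟩ : ∃ τ : Equiv.Perm (Fin 8), ⇑τ = ![0, 7, 6, 5, 4, 3, 2, 1] ∧
      (Equiv.Perm.sign τ : ℤ) = -1 :=
    -- The reversal of 1, …, 7 produced by duality is odd. This turns 28 into -28 = -14 · 2; the
    -- relabelling of the cross-ratio term is even, and -6 = -14 · 3/7.
    ⟨wordPerm [(1, 7), (2, 6), (3, 5)], by decide +kernel, sign_wordPerm (by decide)⟩
  obtain ⟨τ₂, hτ₂, h₂⟩ : ∃ τ : Equiv.Perm (Fin 8), ⇑τ = ![7, 5, 6, 2, 3, 4, 1, 0] ∧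
      (Equiv.Perm.sign τ : ℤ) = 1 :=
    ⟨wordPerm [(0, 7), (1, 5), (2, 6), (3, 6), (4, 6), (5, 6)], by decide +kernel,
      sign_wordPerm (by decide)⟩
  -- Two relabellings that carry the standard cross-ratio (0 1 | 2 3 4 5) to the two factors (7 0 |
  -- 1 2 3 4) and (7 1 | 0 4 5 6).
  have hp : ⇑(wordPerm [(0, 7), (1, 7), (2, 7), (3, 7), (4, 7), (5, 7), (6, 7)]) =
    ![7, 0, 1, 2, 3, 4, 5, 6] := by decide +kernel
  have hq : ⇑(wordPerm [(0, 7), (2, 7), (3, 4), (4, 5), (5, 6), (6, 7)]) =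
    ![7, 1, 0, 4, 5, 6, 2, 3] := by decide +kernel
  have e₁ : dualCombination w.1 = Alt (fun x => (28 : Coeff) • g₁ (x ∘ τ₁) +
      (-6 : Coeff) • g₂ (x ∘ τ₂)) v.1 := by
    rw [dualCombination]
    refine Alt_congr fun σ => ?_
    have hv := v.2.comp_perm σ
    have c₁ := h.crossRatio_comp
      (σ * wordPerm [(0, 7), (1, 7), (2, 7), (3, 7), (4, 7), (5, 7), (6, 7)])
    rw [reidx _ _ hp, reidx _ _ hp] at c₁
    have c₂ := h.crossRatio_comp
      (σ * wordPerm [(0, 7), (2, 7), (3, 4), (4, 5), (5, 6), (6, 7)])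
    rw [reidx _ _ hq, reidx _ _ hq] at c₂
    have c₁' : crossRatio (w.1 ∘ σ) 7 0 1 2 3 4 = crossRatio (v.1 ∘ σ) 5 6 1 2 3 4 := c₁
    have c₂' : crossRatio (w.1 ∘ σ) 7 1 0 4 5 6 = crossRatio (v.1 ∘ σ) 2 3 0 4 5 6 := c₂
    have c₃ : g₁ ((v.1 ∘ σ) ∘ ![0, 7, 6, 5, 4, 3, 2, 1]) =
        (gen3 (tripleRatio (v.1 ∘ σ) 7 6 5 4 3 2 1) ⊗ₜ[Coeff]
          cls (det4 (v.1 ∘ σ) 6 5 3 2), 0) := rfl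
    have c₄ : g₂ ((v.1 ∘ σ) ∘ ![7, 5, 6, 2, 3, 4, 1, 0]) =
        (0, wedge (gen2 (crossRatio (v.1 ∘ σ) 5 6 2 3 4 1))
          (gen2 (crossRatio (v.1 ∘ σ) 2 3 5 6 4 0))) := rfl
    -- Each factor of the wedge product needs one reordering of its arguments, and each reordering
    -- changes the sign, so the two signs cancel.
    rw [hτ₁, hτ₂, c₃, c₄, gen2_crossRatio_rotate hv (i := 1) (by decide),
      gen2_crossRatio_inv (v.1 ∘ σ) 2 3 0 4 5 6, wedge_neg_left,
      wedge_neg_right, neg_neg, h.tripleRatio_comp, h.cls_det4_comp, c₁', c₂']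
    refine Prod.ext ?_ ?_ <;> simp
  have e₂ : f7 F (d F 7 (Finsupp.single v 1)) =
      Alt (fun x => (2 : Coeff) • g₁ x + threeSevenths • g₂ x) v.1 := by
    rw [f7_d_single]
    refine Alt_congr fun σ => Prod.ext ?_ ?_ <;> simp [g₁, g₂]
  rw [e₁, e₂, Alt_add, Alt_add, Alt_smul, Alt_smul, Alt_smul, Alt_smul, Alt_comp_perm,
    Alt_comp_perm, h₁, h₂, smul_add, smul_smul, smul_smul, neg_one_smul, one_smul, smul_neg,
    ← neg_smul]
  congr 2
  · norm_num
  · linear_combination 2 * seven_mul_threeSevenths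

/-! ### Existence of dual configurations -/

/-- Gale duality: the columns of B form a basis of the kernel of the 4 × 8 matrix (A | C) whose
columns are the vectors v. Its minors are proportional, up to sign, to the complementary minors of
(A | C), by the block argument behind Jacobi's identity. -/
theorem exists_isDual_vectors (v : Fin 8 → Fin 4 → F) (hv : GeneralPosition v) :
    ∃ w : Fin 8 → Fin 4 → F, IsDual v w := by
  let ι : Fin 4 ⊕ Fin 4 ≃ Fin 8 := finSumFinEquiv
  let A : Matrix (Fin 4) (Fin 4) F := Matrix.of fun a k => v (ι (.inl k)) a
  let C : Matrix (Fin 4) (Fin 4) F := Matrix.of fun a k => v (ι (.inr k)) a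
  have hA : IsUnit A.det := by
    refine isUnit_iff_ne_zero.mpr ?_
    have h := hv.det4_ne_zero (i := 0) (j := 1) (k := 2) (l := 3) (by decide)
    have e : A = (Matrix.of ![v 0, v 1, v 2, v 3]).transpose := by
      ext a k; fin_cases k <;> rfl
    rwa [e]
  let B : Matrix (Fin 4 ⊕ Fin 4) (Fin 4) F := Matrix.fromRows (-(A⁻¹ * C)) 1
  let M : Matrix (Fin 4 ⊕ Fin 4) (Fin 4 ⊕ Fin 4) F := Matrix.fromBlocks 0 1 A C
  -- The minors of B alone are dual only up to the common factor det M; scaling one coordinate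
  -- corrects this.
  refine ⟨fun i a => B (ι.symm i) a * if a = 0 then M.det else 1, fun σ => ?_⟩
  let τ : Equiv.Perm (Fin 4 ⊕ Fin 4) := ι.symm.permCongr σ
  have hτ : Equiv.Perm.sign τ = Equiv.Perm.sign σ := Equiv.Perm.sign_permCongr _ _
  let E : Matrix (Fin 4 ⊕ Fin 4) (Fin 4) F := Matrix.of fun i k => if i = τ (.inr k) then 1 else 0
  let X : Matrix (Fin 4 ⊕ Fin 4) (Fin 4 ⊕ Fin 4) F := Matrix.fromCols B E
  let V : Matrix (Fin 4) (Fin 4) F := Matrix.of fun a k => v (σ (ι (.inr k))) a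
  let W : Matrix (Fin 4) (Fin 4) F := Matrix.of fun k a => B (τ (.inl k)) a
  -- Here det X is computed twice. Permuting its rows by τ makes it block triangular with blocks W
  -- and 1; multiplying it by M, below, gives block triangular form with blocks 1 and V, because (A
  -- | C) annihilates B.
  have hX : (Equiv.Perm.sign σ : F) * X.det = W.det := by
    rw [← hτ, ← Matrix.det_permute]
    have e : X.submatrix τ id =
        Matrix.fromBlocks W 0 (Matrix.of fun k a => B (τ (.inr k)) a) 1 := by
      ext i j
      rcases i with i | i <;> rcases j with j | j <;>
        simp [X, E, W, Matrix.one_apply]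
    rw [e, Matrix.det_fromBlocks_zero₁₂, Matrix.det_one, mul_one]
  have hMX : M.det * X.det = V.det := by
    rw [← Matrix.det_mul]
    have e : M * X = Matrix.fromBlocks 1 (Matrix.of fun a k => M (.inl a) (τ (.inr k))) 0 V := by
      have hB : M * B = Matrix.fromRows 1 0 := by
        rw [Matrix.fromBlocks_mul_fromRows, Matrix.zero_mul, Matrix.one_mul, zero_add,
          Matrix.mul_neg, ← Matrix.mul_assoc, Matrix.mul_nonsing_inv A hA, Matrix.one_mul,
          Matrix.mul_one, neg_add_cancel]
      have hE : ∀ i k, (M * E) i k = M i (τ (.inr k)) := fun i k => by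
        simp [Matrix.mul_apply, E]
      have hM : ∀ a j, M (.inr a) j = v (ι j) a := fun a j => by rcases j with j | j <;> rfl
      rw [Matrix.mul_fromCols, hB]
      ext i j
      rcases i with i | i <;> rcases j with j | j
      · rfl
      · exact hE _ _
      · rfl
      · refine (hE _ _).trans ((hM _ _).trans ?_)
        simp [τ, V]
    rw [e, Matrix.det_fromBlocks_zero₂₁, Matrix.det_one, one_mul]
  have hV : V.det = det4 v (σ 4) (σ 5) (σ 6) (σ 7) := by
    rw [det4]
    congr 1
    ext a k
    fin_cases k <;> rfl
  have hW : det4 (fun i a => B (ι.symm i) a * if a = 0 then M.det else 1) (σ 0) (σ 1) (σ 2) (σ 3) =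
      W.det * M.det := by
    have e : Matrix.of ![fun a => B (ι.symm (σ 0)) a * if a = 0 then M.det else 1,
        fun a => B (ι.symm (σ 1)) a * if a = 0 then M.det else 1,
        fun a => B (ι.symm (σ 2)) a * if a = 0 then M.det else 1,
        fun a => B (ι.symm (σ 3)) a * if a = 0 then M.det else 1] =
        W * Matrix.diagonal fun a : Fin 4 => if a = 0 then M.det else 1 := by
      ext k a
      rw [Matrix.mul_diagonal]
      fin_cases k <;> rfl
    rw [det4, e, Matrix.det_transpose, Matrix.det_mul, Matrix.det_diagonal,
      Finset.prod_ite_eq' Finset.univ (0 : Fin 4) fun _ => M.det, if_pos (Finset.mem_univ _)]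
  rw [hW, ← hX, ← hV, ← hMX]
  ring

/-- By 4-transitivity of 𝔖₈, any four distinct indices are the first four values of a permutation;
the minor of w is then, up to sign, a nonzero minor of v. -/
theorem IsDual.generalPosition {v w : Fin 8 → Fin 4 → F} (h : IsDual v w)
    (hv : GeneralPosition v) : GeneralPosition w := by
  intro s hs
  obtain ⟨σ, hσ⟩ := (Equiv.Perm.isMultiplyPretransitive (Fin 8) 4).exists_smul_eq
    (Fin.castLEEmb (by norm_num : 4 ≤ 8)) ⟨s, hs⟩
  have e : ∀ k : Fin 4, s k = σ (Fin.castLE (by norm_num) k) := fun k =>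
    (DFunLike.congr_fun hσ k).symm
  have h' := h σ
  have hn : det4 w (s 0) (s 1) (s 2) (s 3) ≠ 0 := by
    rw [e, e, e, e]
    refine h'.trans_ne (mul_ne_zero ?_ (hv.det4_ne_zero ?_))
    · rcases Int.units_eq_one_or (Equiv.Perm.sign σ) with hσ | hσ <;> simp [hσ]
    · exact (show [(4 : Fin 8), 5, 6, 7].Nodup by decide).map σ.injective
  rw [det4, Matrix.det_transpose] at hn
  have e' : (Matrix.of ![w (s 0), w (s 1), w (s 2), w (s 3)]) = Matrix.of (w ∘ s) := by
    ext a b; fin_cases a <;> rfl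
  rw [e'] at hn
  exact Matrix.linearIndependent_rows_iff_isUnit.mpr
    ((Matrix.isUnit_iff_isUnit_det _).mpr (isUnit_iff_ne_zero.mpr hn))

theorem exists_isDual (v : Conf F 8) : ∃ w : Conf F 8, IsDual v.1 w.1 := by
  obtain ⟨w, hw⟩ := exists_isDual_vectors v.1 v.2
  exact ⟨⟨w, hw.generalPosition v.2⟩, hw⟩

/-- By linearity one configuration suffices. The vanishing is transported from the dual one, and the
factor -14 is cancelled, being a unit. -/
theorem cobracket_symbol_f7_d (c : Chains F 8) : cobracket F (S F (f7 F (d F 7 c))) = 0 := by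
  have e : cobracket F ∘ₗ S F ∘ₗ f7 F ∘ₗ d F 7 = 0 := by
    refine Finsupp.lhom_ext' fun v => LinearMap.ext_ring ?_
    obtain ⟨w, hw⟩ := exists_isDual v
    have h := cobracket_symbol_dualCombination w.2
    rw [hw.dualCombination_eq, map_smul, map_smul] at h
    have hu : IsUnit (-14 : Coeff) := by
      rw [show (-14 : Coeff) = -(2 * 7) by norm_num]
      exact (isUnit_two.mul isUnit_seven).neg
    exact hu.smul_eq_zero.mp h
  exact LinearMap.congr_fun e c

end Weight4

theorem mainTheorem3 {F : Type*} [Field F] :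
    (∀ v : Weight4.Conf F 8,
      Weight4.cobracket F (Weight4.S F (Weight4.dualCombination v.1)) = 0) ∧
    (∀ c : Weight4.Chains F 8,
      Weight4.cobracket F (Weight4.S F (Weight4.f7 F (Weight4.d F 7 c))) = 0) ∧
    (∀ v w : Weight4.Conf F 8, Weight4.IsDual v.1 w.1 →
      Weight4.dualCombination w.1 =
        (-14 : Weight4.Coeff) • Weight4.f7 F (Weight4.d F 7 (Finsupp.single v 1))) :=
  ⟨fun v => Weight4.cobracket_symbol_dualCombination v.2, Weight4.cobracket_symbol_f7_d,
    fun _ _ h => h.dualCombination_eq⟩
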